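/- **Setting.** Let $D\in\mathbb N$, $\mathbb Z_+=\{0,1,2,\dots\}$, let $\pi_0$ be a probability measure (the prior) on a measurable space $\mathsf X$, and let $L,\ L_\alpha:\mathsf X\to[0,\infty)$ ($\alpha\in\mathbb Z_+^D$) be measurable. For bounded measurable $\zeta:\mathsf X\to\mathbb R$ put $f(\zeta)=\int\zeta L\,d\pi_0$, $Z=f(1)$, $f_\alpha(\zeta)=\int\zeta L_\alpha\,d\pi_0$. Let $\Delta=\Delta_D\circ\cdots\circ\Delta_1$, where $\Delta_i g_\alpha=g_\alpha-g_{\alpha-e_i}$ if $\alpha_i>0$ and $\Delta_i g_\alpha=g_\alpha$ if $\alpha_i=0$. Index the coordinates of $\mathbf x\in\mathsf X^{2^D}$ by the subsets $S\subseteq\{1,\dots,D\}$, write $\alpha_S=\alpha-\sum_{i\in S}e_i$, and let $L_{\alpha_S}:=0$ if $\alpha_S$ has a negative entry. Let $\Pi_0$ be the law of $(x,\dots,x)$, $x\sim\pi_0$, and $$\mathbf L_\alpha(\mathbf x)=\max_S L_{\alpha_S}(\mathbf x_S),\qquad F_\alpha(d\mathbf x)=\mathbf L_\alpha(\mathbf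 x)\,\Pi_0(d\mathbf x).$$ Given approximations $\zeta_\alpha:\mathsf X\to\mathbb R$ of $\zeta$, set $$\psi_{\zeta_\alpha}(\mathbf x)=\sum_S(-1)^{|S|}\frac{L_{\alpha_S}(\mathbf x_S)}{\mathbf L_\alpha(\mathbf x)}\,\zeta_{\alpha_S}(\mathbf x_S),$$ where the terms with $\alpha_S\notin\mathbb Z_+^D$ are zero (and $0/0:=0$). **SMC sampler.** Let $J\ge1$. For each $\alpha$ let $F_{\alpha,0}=\Pi_0$ and $F_{\alpha,j+1}=H_{\alpha,j}F_{\alpha,j}$ for $0\le j<J$, with measurable $H_{\alpha,j}$ such that $F_{\alpha,1}$ is a probability measure and $F_{\alpha,J}=F_\alpha$ (for instance $F_{\alpha,1}=\Pi_0$, $H_{\alpha,0}=1$), and let $M_{\alpha,j}$, $2\le j\le J$, be Markov kernels on $\mathsf X^{2^D}$ leaving $F_{\alpha,j}/F_{\alpha,j}(1)$ invariant. The sampler with $n$ particles draws $\mathbf x_1^1,\dots,\mathbf x_1^n$ independently from $F_{\alpha,1}$; for $j=2,\dots,J$, given $\mathbf x_{j-1}^1,\dots,\mathbf x_{j-1}^n$,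 the $\mathbf x_j^i$ ($i=1,\dots,n$) are independent, each obtained by selecting an index $k$ with probability $H_{\alpha,j-1}(\mathbf x_{j-1}^k)/\sum_l H_{\alpha,j-1}(\mathbf x_{j-1}^l)$ and drawing from $M_{\alpha,j}(\mathbf x_{j-1}^k,\cdot)$. It outputs $$F_\alpha^n(\psi)=\Big(\prod_{j=1}^{J-1}\frac1n\sum_{i=1}^nH_{\alpha,j}(\mathbf x_j^i)\Big)\,\frac1n\sum_{i=1}^n\psi(\mathbf x_J^i).$$ **Randomized estimator.** Let $N_{\min}\ge1$ be a fixed integer, $N$ a positive multiple of $N_{\min}$, and $p=(p_\alpha)$ a probability distribution on $\mathbb Z_+^D$ with $p_\alpha>0$ for all $\alpha$. Draw $N/N_{\min}$ i.i.d. indices $\alpha_i\sim p$ and let $N_\alpha=N_{\min}\#\{i:\alpha_i=\alpha\}$. Given these draws, run independent SMC samplers, with $N_\alpha$ particles for the index $\alpha$, and set $$\widehat F^{\rm rMI}(\zeta)=\sum_{\alpha\in\mathbb Z_+^D}\frac{N_\alpha}{N\,p_\alpha}\,F_\alpha^{N_\alpha}(\psi_{\zeta_\alpha}).$$ **Assumptions.**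 1. For each $0\le j<J$ there is $C>0$ with $C^{-1}<Z\le C$ and $C^{-1}<H_{\alpha,j}(\mathbf x)\le C$ for all $\alpha\in\mathbb Z_+^D$, $\mathbf x\in\mathsf X^{2^D}$. 2. $\zeta$ and each $\zeta_\alpha$ are bounded and measurable, and $f_\alpha(\zeta_\alpha)\to f(\zeta)$ as $\min_i\alpha_i\to\infty$. (For $D\ge1$ this holds in particular if $|f_\alpha(\zeta_\alpha)-f(\zeta)|\le C\prod_i2^{-\alpha_is_i}$ with $s_i>0$.) 3. There are $\beta_1,\dots,\beta_D>0$ and $C>0$ with $\int_{\mathsf X}\big(\Delta(L_\alpha(x)\zeta_\alpha(x))\big)^2\pi_0(dx)\le C\prod_{i=1}^D2^{-\alpha_i\beta_i}$ for all $\alpha\in\mathbb Z_+^D$. **Conclusion.** There is $C>0$, independent of $p$ and $N$, such that for all $p$ and $N$ as above $$\mathbb E\big[(\widehat F^{\rm rMI}(\zeta)-f(\zeta))^2\big]\le\frac CN\Big(\sum_{\alpha}\frac1{p_\alpha}\prod_{i=1}^D2^{-\alpha_i\beta_i}+\sum_{\alpha\ne\alpha'}\prod_{i=1}^D2^{-\alpha_i\beta_i/2}\prod_{j=1}^D2^{-\alpha'_j\beta_j/2}\Big)$$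 (the first sum may be $+\infty$), and the second sum is finite. In particular, the canonical rate holds whenever the first sum is bounded: for every $K$ there is $C'>0$ such that, for every $p$ with $\sum_\alpha p_\alpha^{-1}\prod_i2^{-\alpha_i\beta_i}\le K$ and every $N$, $\mathbb E\big[(\widehat F^{\rm rMI}(\zeta)-f(\zeta))^2\big]\le C'/N$. -/

import Mathlib

open MeasureTheory ProbabilityTheory Filter Topology
open scoped ENNReal NNReal

noncomputable section

namespace MISMC

/-! ### Multi-indices and mixed differences -/

/-- Multi-indices `α ∈ ℤ₊^D`, where `ℤ₊ = {0, 1, 2, …}`. -/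
abbrev MultiIndex (D : ℕ) : Type := Fin D → ℕ

variable {D : ℕ}

/-- The first-order difference operator `Δ_i` in direction `i`: `g α - g (α - e_i)` if `α_i > 0`, and
`g α` if `α_i = 0`. -/
def diffAlong (i : Fin D) (g : MultiIndex D → ℝ) : MultiIndex D → ℝ := fun α =>
  if 0 < α i then g α - g (Function.update α i (α i - 1)) else g α

/-- The first-order mixed difference operator `Δ = Δ_D ∘ ⋯ ∘ Δ_1`. -/
def mixedDiff (g : MultiIndex D → ℝ) : MultiIndex D → ℝ :=
  (List.finRange D).foldl (fun h i => diffAlong i h) g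

/-- The `2^D` multi-indices that enter `Δ` at `α` are indexed by the subsets `S` of the set of
directions: `α - ∑_{i ∈ S} e_i`. It belongs to `ℤ₊^D` exactly when `Admissible α S`. -/
def lower (α : MultiIndex D) (S : Finset (Fin D)) : MultiIndex D :=
  fun i => if i ∈ S then α i - 1 else α i

/-- `α - ∑_{i ∈ S} e_i` has no negative entry. -/
def Admissible (α : MultiIndex D) (S : Finset (Fin D)) : Prop := ∀ i ∈ S, 0 < α i

instance (α : MultiIndex D) (S : Finset (Fin D)) : Decidable (Admissible α S) :=
  inferInstanceAs (Decidable (∀ i ∈ S, 0 < α i))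

/-! ### The target, its approximations and the approximate couplings -/

/-- The coupled space `𝖷^(2^D)`; its coordinates are indexed by the subsets of the directions. -/
abbrev Coupled (D : ℕ) (X : Type*) : Type _ := Finset (Fin D) → X

variable {X : Type*} [MeasurableSpace X]

/-- `f(ζ) = ∫ ζ(x) L(x) π₀(dx)`, for the unnormalized density `L` with respect to the prior `π₀`. -/
def unnorm (π₀ : Measure X) (L ζ : X → ℝ) : ℝ := ∫ x, ζ x * L x ∂π₀

/-- The prior coupling `Π₀(d𝐱) = π₀(d𝐱₁) ∏_{i ≥ 2} δ_{𝐱₁}(d𝐱ᵢ)`: all coordinates are equal to one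
draw from the prior. -/
def priorCoupling (D : ℕ) (π₀ : Measure X) : Measure (Coupled D X) :=
  π₀.map (fun x _ => x)

/-- The likelihood `L_{α - ∑_{i ∈ S} e_i}`; approximations with a negative index are zero, in
accordance with the convention for `Δ_i` when `α_i = 0`. -/
def lowerLike (Lα : MultiIndex D → X → ℝ) (α : MultiIndex D) (S : Finset (Fin D)) (x : X) : ℝ :=
  if Admissible α S then Lα (lower α S) x else 0

/-- The coupled likelihood `𝐋_α(𝐱)`, the maximum of the `2^D` likelihoods. -/
def coupledLike (Lα : MultiIndex D → X → ℝ) (α : MultiIndex D) (x : Coupled D X) : ℝ :=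
  Finset.univ.sup' Finset.univ_nonempty (fun S => lowerLike Lα α S (x S))

/-- The approximate coupling `F_α(d𝐱) = 𝐋_α(𝐱) Π₀(d𝐱)`, unnormalized. -/
def approxCoupling (π₀ : Measure X) (Lα : MultiIndex D → X → ℝ) (α : MultiIndex D) :
    Measure (Coupled D X) :=
  (priorCoupling D π₀).withDensity (fun x => ENNReal.ofReal (coupledLike Lα α x))

/-- The test function `ψ_{ζ_α}(𝐱) = ∑_k ι_k ω_k(𝐱) ζ_{𝛂_k(α)}(𝐱_k)`, with
`ω_k(𝐱) = L_{𝛂_k(α)}(𝐱_k) / 𝐋_α(𝐱)` and `ι_k` the sign of the `k`-th term of `Δ` at `α`. -/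
def psi (Lα ζα : MultiIndex D → X → ℝ) (α : MultiIndex D) (x : Coupled D X) : ℝ :=
  ∑ S : Finset (Fin D),
    (-1) ^ S.card * (lowerLike Lα α S (x S) / coupledLike Lα α x) * ζα (lower α S) (x S)

/-! ### The sequential Monte Carlo sampler -/

section Sampler

variable {E : Type*} [MeasurableSpace E]

/-- The measures `F_0 = μ`, `F_{j+1}(dx) = H_j(x) F_j(dx)`. -/
def intermediate (μ : Measure E) (H : ℕ → E → ℝ) : ℕ → Measure E
  | 0 => μ
  | j + 1 => (intermediate μ H j).withDensity (fun x => ENNReal.ofReal (H j x))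

/-- The probability measure `μ / μ(E)`. -/
def normalized (μ : Measure E) : Measure E := (μ Set.univ)⁻¹ • μ

/-- The empirical mean `(1/n) ∑ᵢ h(xⁱ)`. -/
def empMean {n : ℕ} (h : E → ℝ) (x : Fin n → E) : ℝ := (∑ i, h (x i)) / n

/-- The law of one resampled and mutated particle, given the current particles `x`: draw an index `k`
with probability `h(xᵏ) / ∑ₗ h(xˡ)`, then move from `xᵏ` by the Markov kernel `M`. -/
def resampleMutate {n : ℕ} (h : E → ℝ) (M : Kernel E E) (x : Fin n → E) : Measure E :=
  (∑ k, ENNReal.ofReal (h (x k) / ∑ l, h (x l)) • Measure.dirac (x k)).bind M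

/-- The joint law of `(𝐙_{j+1}, (𝐱_{j+1}ⁱ)_{i ≤ n})` for the SMC sampler with `n` particles, with
`𝐙_1 = 1` and `𝐱_1ⁱ` independent draws from `F_1`; given the state at stage `j + 1`,
`𝐙_{j+2} = 𝐙_{j+1} (1/n) ∑ᵢ H_{j+1}(𝐱_{j+1}ⁱ)` and the new particles are independently resampled
with weights proportional to `H_{j+1}` and mutated by `M_{j+2}`. -/
def smcLaw (μ : Measure E) (H : ℕ → E → ℝ) (M : ℕ → Kernel E E) (n : ℕ) :
    ℕ → Measure (ℝ × (Fin n → E))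
  | 0 => (Measure.pi (fun _ : Fin n => intermediate μ H 1)).map (fun x => (1, x))
  | j + 1 => (smcLaw μ H M n j).bind (fun s =>
      (Measure.pi (fun _ : Fin n => resampleMutate (H (j + 1)) (M (j + 2)) s.2)).map
        (fun x => (s.1 * empMean (H (j + 1)) s.2, x)))

end Sampler

/-- The ingredients of the SMC samplers for all the approximate couplings: the number `J` of
distributions, and for every `α` intermediate distributions `F_{α,1}, …, F_{α,J} = F_α` with
`F_{α,j+1} = H_{α,j} F_{α,j}`, where `F_{α,0} = Π₀` and `F_{α,1}` is a probability measure, from which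
the sampler starts (`F_{α,1} = Π₀`, `H_{α,0} = 1` being the typical choice); and Markov kernels
`M_{α,j}`, `2 ≤ j ≤ J`, that leave `Π_{α,j} = F_{α,j} / F_{α,j}(1)` invariant. The values of `H α j` for
`J ≤ j` and of `M α j` for `j ≤ 1` or `J < j` are not used. -/
structure SMCData (π₀ : Measure X) (Lα : MultiIndex D → X → ℝ) where
  J : ℕ
  one_le_J : 1 ≤ J
  H : MultiIndex D → ℕ → Coupled D X → ℝ
  measurable_H : ∀ α j, Measurable (H α j)
  M : MultiIndex D → ℕ → Kernel (Coupled D X) (Coupled D X)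
  markov_M : ∀ α j, IsMarkovKernel (M α j)
  isProbability_first : ∀ α, IsProbabilityMeasure (intermediate (priorCoupling D π₀) (H α) 1)
  last_eq : ∀ α, intermediate (priorCoupling D π₀) (H α) J = approxCoupling π₀ Lα α
  invariant : ∀ α j, 2 ≤ j → j ≤ J →
    (M α j).Invariant (normalized (intermediate (priorCoupling D π₀) (H α) j))

/-- The law of `F_α^n(ψ) = 𝐙_α^n (1/n) ∑ᵢ ψ(𝐱_Jⁱ)` for the SMC sampler with `n` particles. -/
def SMCData.estimatorLaw {π₀ : Measure X} {Lα : MultiIndex D → X → ℝ} (s : SMCData π₀ Lα)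
    (ψ : Coupled D X → ℝ) (α : MultiIndex D) (n : ℕ) : Measure ℝ :=
  (smcLaw (priorCoupling D π₀) (s.H α) (s.M α) n (s.J - 1)).map (fun z => z.1 * empMean ψ z.2)

/-! ### Assumptions -/

/-- The normalizing constant `Z = f(1)` and the ratios `H_{α,j}` are bounded above and below by
positive constants, uniformly in `α` and `𝐱`. -/
def UniformBounds {π₀ : Measure X} {Lα : MultiIndex D → X → ℝ} (L : X → ℝ)
    (s : SMCData π₀ Lα) : Prop :=
  ∀ j < s.J, ∃ C : ℝ, 0 < C ∧
    (C⁻¹ < unnorm π₀ L (fun _ => 1) ∧ unnorm π₀ L (fun _ => 1) ≤ C) ∧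
    ∀ α x, C⁻¹ < s.H α j x ∧ s.H α j x ≤ C

/-- `∏ᵢ 2^{-αᵢ βᵢ}`. -/
def rate (β : Fin D → ℝ) (α : MultiIndex D) : ℝ := ∏ i, (2 : ℝ) ^ (-((α i : ℝ) * β i))

/-- The bias vanishes: `f_α(ζ_α) → f(ζ)` as all the entries of `α` tend to infinity. -/
def BiasVanishes (π₀ : Measure X) (L : X → ℝ) (Lα : MultiIndex D → X → ℝ) (ζ : X → ℝ)
    (ζα : MultiIndex D → X → ℝ) : Prop :=
  Tendsto (fun α => unnorm π₀ (Lα α) (ζα α)) atTop (𝓝 (unnorm π₀ L ζ))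

/-- A bias rate `|f_α(ζ_α) - f(ζ)| ≤ C ∏ᵢ 2^{-αᵢ rᵢ}` is a special case. -/
theorem biasVanishes_of_rate {π₀ : Measure X} {L : X → ℝ} {Lα : MultiIndex D → X → ℝ} {ζ : X → ℝ}
    {ζα : MultiIndex D → X → ℝ} (hD : 0 < D) (C : ℝ) (r : Fin D → ℝ) (hr : ∀ i, 0 < r i)
    (h : ∀ α, |unnorm π₀ (Lα α) (ζα α) - unnorm π₀ L ζ| ≤ C * rate r α) :
    BiasVanishes π₀ L Lα ζ ζα := by
  have hrate : Tendsto (fun α : MultiIndex D => C * rate r α) atTop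
      (𝓝 (C * ∏ _i : Fin D, (0 : ℝ))) := by
    refine Tendsto.const_mul _ (tendsto_finsetProd _ fun i _ => ?_)
    have h1 : Tendsto (fun α : MultiIndex D => (α i : ℝ) * r i) atTop atTop :=
      (tendsto_natCast_atTop_atTop.comp (Filter.tendsto_atTop_atTop.2 fun b =>
        ⟨fun _ => b, fun α hα => hα i⟩)).atTop_mul_const (hr i)
    exact (tendsto_rpow_atBot_of_base_gt_one 2 (by norm_num)).comp
      (tendsto_neg_atTop_atBot.comp h1)
  have h0 : C * ∏ _i : Fin D, (0 : ℝ) = 0 := by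
    simp [hD.ne']
  rw [h0] at hrate
  unfold BiasVanishes
  rw [tendsto_iff_norm_sub_tendsto_zero]
  exact squeeze_zero (fun _ => norm_nonneg _) h hrate

/-- The variance rate: `∫ (Δ(L_α(x) ζ_α(x)))² π₀(dx) ≤ C ∏ᵢ 2^{-αᵢ βᵢ}` for all `α`. -/
def VarianceRate (π₀ : Measure X) (Lα ζα : MultiIndex D → X → ℝ) (β : Fin D → ℝ) : Prop :=
  ∃ C : ℝ, 0 < C ∧ ∀ α,
    ∫ x, (mixedDiff (fun α' => Lα α' x * ζα α' x) α) ^ 2 ∂π₀ ≤ C * rate β α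

/-! ### The randomized estimator -/

/-- The scaled counts `N_α = N_min #{i ; αᵢ = α}`. -/
def count {m : ℕ} (Nmin : ℕ) (a : Fin m → MultiIndex D) (α : MultiIndex D) : ℕ :=
  Nmin * (Finset.univ.filter (fun i => a i = α)).card

/-- The joint law of the `m = N / N_min` independent draws from `p` and of the increment estimators
`F_α^{N_α}(ψ_{ζ_α})`, which given the draws are independent over `α`, the one at `α` coming from an SMC
sampler with `N_α` particles. -/
def rmiLaw {π₀ : Measure X} {Lα : MultiIndex D → X → ℝ} (s : SMCData π₀ Lα)
    (ζα : MultiIndex D → X → ℝ) (p : PMF (MultiIndex D)) (Nmin m : ℕ) :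
    Measure ((Fin m → MultiIndex D) × (MultiIndex D → ℝ)) :=
  (Measure.pi (fun _ : Fin m => p.toMeasure)).bind (fun a =>
    (Measure.infinitePi (fun α => s.estimatorLaw (psi Lα ζα α) α (count Nmin a α))).map
      (fun y => (a, y)))

/-- The estimator `∑_α N_α / (N p_α) F_α^{N_α}(ψ_{ζ_α})`, with `N = N_min m`, as a function of the draws
and of the increment estimators; at most `m` terms are nonzero. -/
def rmiEstimator (p : PMF (MultiIndex D)) (Nmin m : ℕ)
    (w : (Fin m → MultiIndex D) × (MultiIndex D → ℝ)) : ℝ :=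
  ∑' α, (count Nmin w.1 α : ℝ) / (((Nmin * m : ℕ) : ℝ) * (p α).toReal) * w.2 α

/-- The mean square error `𝔼[(F̂^rMI(ζ) - f(ζ))²]`, as a number in `[0, ∞]`. -/
def mse {π₀ : Measure X} {Lα : MultiIndex D → X → ℝ} (s : SMCData π₀ Lα) (L ζ : X → ℝ)
    (ζα : MultiIndex D → X → ℝ) (p : PMF (MultiIndex D)) (Nmin m : ℕ) : ℝ≥0∞ :=
  ∫⁻ w, ENNReal.ofReal ((rmiEstimator p Nmin m w - unnorm π₀ L ζ) ^ 2) ∂(rmiLaw s ζα p Nmin m)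

/-- `∑_α p_α⁻¹ ∏ᵢ 2^{-αᵢ βᵢ}`, as a number in `[0, ∞]`. -/
def diagSum (p : PMF (MultiIndex D)) (β : Fin D → ℝ) : ℝ≥0∞ :=
  ∑' α, (p α)⁻¹ * ENNReal.ofReal (rate β α)

/-- `∑_{α ≠ α'} ∏ᵢ 2^{-αᵢ βᵢ / 2} ∏ⱼ 2^{-α'ⱼ βⱼ / 2}`, as a number in `[0, ∞]`. -/
def crossSum (β : Fin D → ℝ) : ℝ≥0∞ :=
  ∑' α : MultiIndex D, ∑' α' : MultiIndex D,
    if α ≠ α' then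
      ENNReal.ofReal (rate (fun i => β i / 2) α * rate (fun i => β i / 2) α')
    else 0

end MISMC

end

noncomputable section

namespace MISMC

/-! ### Mixed differences -/

section MixedDifferences

variable {D : ℕ}

/-! The estimator is unbiased, so its mean square error is a variance, and the law of total variance
splits this into sampling noise given the drawn indices and noise from the draws. Write `d α` for
the mixed difference of `f_α(ζ_α)`.

Target: mixed differences telescope over boxes, so together with the vanishing bias the `d α` sum to
`f(ζ)` (`tsum_mixedDiff_eq`). Summability holds because `d α ^ 2` is at most a constant times `rate
β α`.

One increment: reweighting by `H` cancels the normalization of the resampling weights and the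
kernels preserve the intermediate distributions, so the SMC estimator has mean `F_α(ψ)` for any
number of particles (`integral_smcLaw`). Propagating second moments through the stages bounds its
variance by a constant times `F_α(ψ²) / n` (`variance_smcLaw_le`), where the second moment of `ψ`,
not its supremum, appears. On the diagonal `𝐋_α ψ = Δ(L_α ζ_α)`, and `𝐋_α` is a product of the
ratios `H`, hence bounded above and below. So the variance is `O(rate β α / n)`
(`exists_moments_estimatorLaw`).

Randomization: given the draws, the weights `N_α / (N p_α)` turn the conditional mean and variance
into empirical means, over the draws, of `d / p` and of `K rate / p²`, the latter divided by `N`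
(`lintegral_rmiEstimator_le`). Under `p` the first has mean `f(ζ)` and variance at most `K diagSum /
m`, and the second has mean `K diagSum` before the division (`lintegral_empMean_le`). The diagonal
sum alone therefore bounds the error; the cross sum only enlarges the bound. -/

theorem admissible_insert {α : MultiIndex D} {S : Finset (Fin D)} {i : Fin D} :
    Admissible α (insert i S) ↔ 0 < α i ∧ Admissible α S := by
  simp [Admissible]

theorem admissible_update {α : MultiIndex D} {S : Finset (Fin D)} {i : Fin D} (hi : i ∉ S) (k : ℕ) :
    Admissible (Function.update α i k) S ↔ Admissible α S := by
  refine forall₂_congr fun j hj => ?_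
  rw [Function.update_of_ne (ne_of_mem_of_not_mem hj hi)]

theorem lower_insert {α : MultiIndex D} {S : Finset (Fin D)} {i : Fin D} (hi : i ∉ S) :
    lower α (insert i S) = lower (Function.update α i (α i - 1)) S := by
  funext j
  by_cases hj : j = i
  · subst hj
    simp [lower, hi]
  · simp [lower, hj]

/-- Applying one more operator splits the subsets by whether they contain the new direction. When `α
i = 0` every subset containing `i` is inadmissible, which is the boundary convention of `diffAlong`.
-/
theorem foldl_diffAlong_eq_sum (l : List (Fin D)) (hl : l.Nodup) (g : MultiIndex D → ℝ)
    (α : MultiIndex D) :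
    l.foldl (fun h i => diffAlong i h) g α =
      ∑ S ∈ l.toFinset.powerset, if Admissible α S then (-1) ^ S.card * g (lower α S) else 0 := by
  induction l using List.reverseRecOn generalizing α with
  | nil =>
    have h : lower α ∅ = α := by funext j; simp [lower]
    simp [Admissible, h]
  | append_singleton l i ih =>
    rw [List.nodup_append_comm] at hl
    simp only [List.singleton_append, List.nodup_cons] at hl
    have hi : i ∉ l.toFinset := by simpa using hl.1
    have hl' : (l ++ [i]).toFinset = insert i l.toFinset := by
      ext; simp
    rw [List.foldl_append, hl', Finset.sum_powerset_insert hi]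
    simp only [List.foldl_cons, List.foldl_nil, diffAlong, ih hl.2]
    by_cases h0 : 0 < α i
    · rw [if_pos h0, sub_eq_add_neg, ← Finset.sum_neg_distrib]
      congr 1
      refine Finset.sum_congr rfl fun S hS => ?_
      have hiS : i ∉ S := fun h => hi (Finset.mem_powerset.1 hS h)
      simp only [admissible_insert, h0, true_and, admissible_update hiS, lower_insert hiS,
        Finset.card_insert_of_notMem hiS, pow_succ]
      split_ifs <;> ring
    · rw [if_neg h0]
      simp [admissible_insert, h0]

theorem mixedDiff_eq_sum (g : MultiIndex D → ℝ) (α : MultiIndex D) :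
    mixedDiff g α =
      ∑ S : Finset (Fin D), if Admissible α S then (-1) ^ S.card * g (lower α S) else 0 := by
  rw [mixedDiff, foldl_diffAlong_eq_sum _ (List.nodup_finRange D)]
  simp

theorem sum_range_diffAlong (i : Fin D) (h : MultiIndex D → ℝ) (α : MultiIndex D) (n : ℕ) :
    ∑ k ∈ Finset.range (n + 1), diffAlong i h (Function.update α i k) =
      h (Function.update α i n) := by
  induction n with
  | zero => simp [diffAlong]
  | succ n ih => rw [Finset.sum_range_succ, ih]; simp [diffAlong]

/-- The multi-indices below `A` that agree with `A` outside of the directions in `l`. -/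
def partialBox (l : List (Fin D)) (A : MultiIndex D) : Finset (MultiIndex D) :=
  Fintype.piFinset fun i => if i ∈ l then Finset.range (A i + 1) else {A i}

/-- The boundary convention makes the sum of `diffAlong i` over `0, …, A i` telescope with nothing
left at the lower end. Directions outside `l` stay frozen at `A`, so the induction frees one
direction at a time. -/
theorem sum_partialBox_foldl_diffAlong (l : List (Fin D)) (hl : l.Nodup) (g : MultiIndex D → ℝ)
    (A : MultiIndex D) :
    ∑ α ∈ partialBox l A, l.foldl (fun h i => diffAlong i h) g α = g A := by
  induction l using List.reverseRecOn with
  | nil => simp [partialBox, Fintype.piFinset_singleton]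
  | append_singleton l i ih =>
    rw [List.nodup_append_comm] at hl
    simp only [List.singleton_append, List.nodup_cons] at hl
    rw [List.foldl_append]
    simp only [List.foldl_cons, List.foldl_nil]
    set h := l.foldl (fun h i => diffAlong i h) g with hh
    rw [← ih hl.2]
    have hmem : ∀ α, α ∈ partialBox l A → α i = A i := by
      intro α hα
      have := Fintype.mem_piFinset.1 hα i
      simpa [hl.1] using this
    have key : ∀ α ∈ partialBox l A,
        h α = ∑ k ∈ Finset.range (A i + 1), diffAlong i h (Function.update α i k) := by
      intro α hα
      rw [sum_range_diffAlong, ← hmem α hα, Function.update_eq_self]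
    rw [Finset.sum_congr rfl key, ← Finset.sum_product']
    symm
    -- A point of the enlarged box is a point of the box frozen in direction `i` together with a
    -- free value of that coordinate.
    refine Finset.sum_nbij' (fun x => Function.update x.1 i x.2)
      (fun α => (Function.update α i (A i), α i)) ?_ ?_ ?_ ?_ ?_
    · rintro ⟨α, k⟩ hx
      simp only [Finset.mem_product, partialBox, Fintype.mem_piFinset] at hx ⊢
      intro j
      by_cases hj : j = i
      · subst hj; simpa using hx.2
      · have := hx.1 j
        simpa [hj] using this
    · intro α hα
      simp only [Finset.mem_product, partialBox, Fintype.mem_piFinset] at hα ⊢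
      refine ⟨fun j => ?_, by simpa using hα i⟩
      by_cases hj : j = i
      · subst hj; simp [hl.1]
      · have := hα j
        simpa [hj] using this
    · rintro ⟨α, k⟩ hx
      have := hmem α (Finset.mem_product.1 hx).1
      simp [← this]
    · intro α _
      simp
    · intro x _
      rfl

theorem sum_Iic_mixedDiff (g : MultiIndex D → ℝ) (A : MultiIndex D) :
    ∑ α ∈ Finset.Iic A, mixedDiff g α = g A := by
  rw [← sum_partialBox_foldl_diffAlong _ (List.nodup_finRange D) g A]
  refine Finset.sum_congr ?_ fun _ _ => rfl
  ext α
  simp [partialBox, Fintype.mem_piFinset, Pi.le_def]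

/-- The mixed differences of a convergent multi-indexed sequence sum to its limit. -/
theorem tsum_mixedDiff_eq {g : MultiIndex D → ℝ} {a : ℝ} (hg : Tendsto g atTop (𝓝 a))
    (hs : Summable (mixedDiff g)) : ∑' α, mixedDiff g α = a := by
  refine tendsto_nhds_unique (hs.hasSum.comp tendsto_finset_Iic_atTop_atTop) ?_
  refine hg.congr fun A => ?_
  exact (sum_Iic_mixedDiff g A).symm

end MixedDifferences

/-! ### The rates -/

section Rates

variable {D : ℕ}

theorem rate_pos (β : Fin D → ℝ) (α : MultiIndex D) : 0 < rate β α :=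
  Finset.prod_pos fun _ _ => Real.rpow_pos_of_pos two_pos _

theorem rate_half_sq (β : Fin D → ℝ) (α : MultiIndex D) :
    rate (fun i => β i / 2) α ^ 2 = rate β α := by
  rw [rate, rate, ← Finset.prod_pow]
  refine Finset.prod_congr rfl fun i _ => ?_
  rw [← Real.rpow_natCast, ← Real.rpow_mul two_pos.le]
  congr 1
  push_cast
  ring

/-- The sum over a box factors into one-dimensional geometric sums, and every finite set of
multi-indices lies in the box spanned by its coordinate projections. -/
theorem summable_rate {β : Fin D → ℝ} (hβ : ∀ i, 0 < β i) : Summable (rate β) := by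
  have hgeo : ∀ i (k : ℕ), (2 : ℝ) ^ (-((k : ℝ) * β i)) = ((2 : ℝ) ^ (-β i)) ^ k := by
    intro i k
    rw [← Real.rpow_natCast, ← Real.rpow_mul two_pos.le]
    congr 1
    ring
  have hsum : ∀ i, Summable fun k : ℕ => (2 : ℝ) ^ (-((k : ℝ) * β i)) := by
    intro i
    simp_rw [hgeo]
    exact summable_geometric_of_lt_one (Real.rpow_nonneg two_pos.le _)
      (Real.rpow_lt_one_of_one_lt_of_neg one_lt_two (neg_neg_of_pos (hβ i)))
  refine summable_of_sum_le (c := ∏ i, ∑' k : ℕ, (2 : ℝ) ^ (-((k : ℝ) * β i)))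
    (fun α => (rate_pos β α).le) fun u => ?_
  have hu : u ⊆ Fintype.piFinset fun i => u.image fun α => α i := fun α hα =>
    Fintype.mem_piFinset.2 fun i => Finset.mem_image_of_mem _ hα
  calc ∑ α ∈ u, rate β α
      ≤ ∑ α ∈ Fintype.piFinset fun i => u.image fun α => α i, rate β α :=
        Finset.sum_le_sum_of_subset_of_nonneg hu fun α _ _ => (rate_pos β α).le
    _ = ∏ i, ∑ k ∈ (u.image fun α : MultiIndex D => α i : Finset ℕ), (2 : ℝ) ^ (-((k : ℝ) * β i)) := by
        rw [Finset.prod_univ_sum]; rfl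
    _ ≤ _ := by
        refine Finset.prod_le_prod (fun i _ => Finset.sum_nonneg fun k _ =>
          Real.rpow_nonneg two_pos.le _) fun i _ => ?_
        exact (hsum i).sum_le_tsum _ fun k _ => Real.rpow_nonneg two_pos.le _

/-- Restoring the terms with `α = α'` gives the square of a convergent sum. -/
theorem crossSum_ne_top {β : Fin D → ℝ} (hβ : ∀ i, 0 < β i) : crossSum β ≠ ⊤ := by
  have hs : Summable (rate fun i => β i / 2) := summable_rate fun i => half_pos (hβ i)
  have hfin : ∑' α, ENNReal.ofReal (rate (fun i => β i / 2) α) ≠ ⊤ := by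
    rw [← ENNReal.ofReal_tsum_of_nonneg (fun α => (rate_pos _ α).le) hs]
    exact ENNReal.ofReal_ne_top
  refine ne_top_of_le_ne_top (ENNReal.mul_ne_top hfin hfin) ?_
  rw [crossSum, ← ENNReal.tsum_mul_right]
  refine ENNReal.tsum_le_tsum fun α => ?_
  rw [← ENNReal.tsum_mul_left]
  refine ENNReal.tsum_le_tsum fun α' => ?_
  split_ifs
  · rw [ENNReal.ofReal_mul (rate_pos _ α).le]
  · exact zero_le

end Rates

/-! ### Integration preliminaries -/

section Integration

variable {A E : Type*} [MeasurableSpace A] [MeasurableSpace E]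

/-- Bounded measurable real functions. -/
def BddMeas (φ : E → ℝ) : Prop := Measurable φ ∧ ∃ B, ∀ x, |φ x| ≤ B

theorem BddMeas.integrable {φ : E → ℝ} (h : BddMeas φ) (μ : Measure E) [IsFiniteMeasure μ] :
    Integrable φ μ :=
  .of_bound h.1.aestronglyMeasurable h.2.choose (ae_of_all _ h.2.choose_spec)

theorem BddMeas.memLp {φ : E → ℝ} (h : BddMeas φ) (μ : Measure E) [IsFiniteMeasure μ] :
    MemLp φ 2 μ :=
  .of_bound h.1.aestronglyMeasurable h.2.choose (ae_of_all _ h.2.choose_spec)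

theorem BddMeas.mul {φ ψ : E → ℝ} (hφ : BddMeas φ) (hψ : BddMeas ψ) :
    BddMeas fun x => φ x * ψ x := by
  obtain ⟨hφ, B, hB⟩ := hφ
  obtain ⟨hψ, B', hB'⟩ := hψ
  refine ⟨hφ.mul hψ, B * B', fun x => ?_⟩
  rw [abs_mul]
  exact mul_le_mul (hB x) (hB' x) (abs_nonneg _) ((abs_nonneg _).trans (hB x))

theorem BddMeas.sq {φ : E → ℝ} (hφ : BddMeas φ) : BddMeas fun x => φ x ^ 2 := by
  simpa only [pow_two] using hφ.mul hφ

theorem BddMeas.integral_kernel {φ : E → ℝ} (hφ : BddMeas φ) (κ : Kernel A E) [IsMarkovKernel κ] :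
    BddMeas fun x => ∫ y, φ y ∂κ x := by
  refine ⟨(hφ.1.stronglyMeasurable.integral_kernel).measurable, hφ.2.choose, fun x => ?_⟩
  have h := norm_integral_le_of_norm_le_const (μ := κ x) (f := φ) (ae_of_all _ hφ.2.choose_spec)
  simpa using h

theorem BddMeas.finsetSum {ι : Type*} (s : Finset ι) {φ : ι → E → ℝ}
    (h : ∀ i ∈ s, BddMeas (φ i)) : BddMeas fun x => ∑ i ∈ s, φ i x := by
  choose! B hB using fun i hi => (h i hi).2
  exact ⟨Finset.measurable_fun_sum s fun i hi => (h i hi).1, ∑ i ∈ s, B i, fun x =>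
    (Finset.abs_sum_le_sum_abs _ _).trans (Finset.sum_le_sum fun i hi => hB i hi x)⟩

theorem BddMeas.comp {φ : E → ℝ} (h : BddMeas φ) {g : A → E} (hg : Measurable g) :
    BddMeas fun x => φ (g x) :=
  ⟨h.1.comp hg, h.2.choose, fun x => h.2.choose_spec (g x)⟩

theorem sq_integral_le {μ : Measure E} [IsProbabilityMeasure μ] {φ : E → ℝ} (h : MemLp φ 2 μ) :
    (∫ x, φ x ∂μ) ^ 2 ≤ ∫ x, φ x ^ 2 ∂μ := by
  have h1 := variance_eq_sub h
  have h2 := variance_nonneg φ μ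
  simp only [Pi.pow_apply] at h1
  linarith

theorem integral_bind_kernel {μ : Measure A} {κ : Kernel A E} {f : E → ℝ}
    (hf : Integrable f (μ.bind κ)) : ∫ z, f z ∂(μ.bind κ) = ∫ x, ∫ y, f y ∂κ x ∂μ := by
  have h : (κ ∘ₖ Kernel.const Unit μ) () = μ.bind κ := by
    rw [Kernel.comp_apply, Kernel.const_apply]
  rw [← h] at hf ⊢
  rw [Kernel.integral_comp hf, Kernel.const_apply]

/-- Product measures depend measurably on their factor. -/
theorem measurable_pi_const {n : ℕ} {κ : A → Measure E} (hκ : Measurable κ)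
    (hp : ∀ a, ∀ _ : Fin n, IsProbabilityMeasure (κ a)) :
    Measurable fun a => Measure.pi fun _ : Fin n => κ a := by
  have (a : A) (i : Fin n) : IsProbabilityMeasure (κ a) := hp a i
  have (a : A) : IsProbabilityMeasure (Measure.pi fun _ : Fin n => κ a) :=
    @Measure.pi.instIsProbabilityMeasure _ _ _ _ (fun _ => κ a) (hp a)
  refine .measure_of_isPiSystem_of_isProbabilityMeasure generateFrom_pi.symm isPiSystem_pi ?_
  rintro _ ⟨s, hs, rfl⟩
  have hs' : ∀ i, MeasurableSet (s i) := fun i => hs i (Set.mem_univ i)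
  have (a : A) : (Measure.pi fun _ : Fin n => κ a) (Set.univ.pi s) = ∏ i, κ a (s i) := by
    have : ∀ i : Fin n, SigmaFinite ((fun _ : Fin n => κ a) i) := fun i =>
      have := hp a i
      inferInstanceAs (SigmaFinite (κ a))
    exact Measure.pi_pi _ s
  simp_rw [this]
  exact Finset.measurable_fun_prod _ fun i _ => (Measure.measurable_coe (hs' i)).comp hκ

end Integration

/-! ### Empirical means of independent draws -/

section EmpiricalMean

variable {E : Type*}

theorem abs_empMean_le {n : ℕ} {φ : E → ℝ} {B : ℝ} (hB0 : 0 ≤ B) (hB : ∀ x, |φ x| ≤ B)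
    (x : Fin n → E) : |empMean φ x| ≤ B := by
  rw [empMean, abs_div, Nat.abs_cast]
  refine div_le_of_le_mul₀ (Nat.cast_nonneg n) hB0 ((Finset.abs_sum_le_sum_abs _ _).trans ?_)
  refine (Finset.sum_le_sum fun i _ => hB (x i)).trans ?_
  simp [mul_comm]

theorem empMean_nonneg {n : ℕ} {φ : E → ℝ} (h : ∀ x, 0 ≤ φ x) (x : Fin n → E) :
    0 ≤ empMean φ x :=
  div_nonneg (Finset.sum_nonneg fun i _ => h (x i)) (Nat.cast_nonneg n)

theorem sum_pos_of_fin {n : ℕ} {h : E → ℝ} (hn : n ≠ 0) (hh : ∀ x, 0 < h x) (x : Fin n → E) :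
    0 < ∑ l, h (x l) := by
  have : Nonempty (Fin n) := ⟨⟨0, Nat.pos_of_ne_zero hn⟩⟩
  exact Finset.sum_pos (fun l _ => hh (x l)) Finset.univ_nonempty

variable [MeasurableSpace E]

theorem measurable_empMean {n : ℕ} {φ : E → ℝ} (hφ : Measurable φ) :
    Measurable (empMean (n := n) φ) := by
  unfold empMean
  fun_prop

variable {n : ℕ} {ν : Measure E} [IsProbabilityMeasure ν] {φ : E → ℝ}

theorem memLp_empMean (hφ : MemLp φ 2 ν) :
    MemLp (empMean (n := n) φ) 2 (Measure.pi fun _ : Fin n => ν) := by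
  have h (i : Fin n) : MemLp (fun x : Fin n → E => φ (x i)) 2 (Measure.pi fun _ : Fin n => ν) :=
    hφ.comp_measurePreserving (measurePreserving_eval (fun _ : Fin n => ν) i)
  have h2 := (memLp_finsetSum Finset.univ fun i _ => h i).const_mul (n : ℝ)⁻¹
  refine h2.ae_eq (ae_of_all _ fun x => ?_)
  rw [empMean]
  ring

theorem integral_empMean (hn : n ≠ 0) (hφ : Integrable φ ν) :
    ∫ x, empMean φ x ∂(Measure.pi fun _ : Fin n => ν) = ∫ x, φ x ∂ν := by
  have h (i : Fin n) := measurePreserving_eval (fun _ : Fin n => ν) i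
  have h1 (i : Fin n) : ∫ x : Fin n → E, φ (x i) ∂(Measure.pi fun _ => ν) = ∫ x, φ x ∂ν := by
    conv_rhs => rw [← (h i).map_eq]
    rw [integral_map (h i).measurable.aemeasurable (by rw [(h i).map_eq]; exact hφ.1)]
  simp only [empMean]
  have h2 (i : Fin n) : Integrable (fun x : Fin n → E => φ (x i)) (Measure.pi fun _ => ν) :=
    (h i).integrable_comp_of_integrable hφ
  rw [integral_div, integral_finsetSum _ fun i _ => h2 i]
  simp only [h1, Finset.sum_const, Finset.card_univ, Fintype.card_fin, nsmul_eq_mul]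
  field_simp

theorem variance_empMean (hn : n ≠ 0) (hφ : MemLp φ 2 ν) :
    Var[empMean φ; Measure.pi fun _ : Fin n => ν] = Var[φ; ν] / n := by
  have h1 : empMean (n := n) φ = fun x => (n : ℝ)⁻¹ * (∑ i, fun ω : Fin n → E => φ (ω i)) x := by
    funext x
    rw [empMean, Finset.sum_apply]
    ring
  rw [h1, variance_const_mul, variance_sum_pi (X := fun _ => φ) fun _ => hφ]
  simp only [Finset.sum_const, Finset.card_univ, Fintype.card_fin, nsmul_eq_mul]
  field_simp

theorem integral_sq_empMean_le (hn : n ≠ 0) (hφ : MemLp φ 2 ν) :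
    ∫ x, empMean φ x ^ 2 ∂(Measure.pi fun _ : Fin n => ν) ≤
      (∫ x, φ x ∂ν) ^ 2 + (∫ x, φ x ^ 2 ∂ν) / n := by
  have h1 := variance_eq_sub (memLp_empMean (n := n) hφ)
  have h2 : Var[φ; ν] ≤ ∫ x, φ x ^ 2 ∂ν := variance_le_expectation_sq hφ.1
  rw [variance_empMean hn hφ, integral_empMean hn (hφ.integrable one_le_two)] at h1
  simp only [Pi.pow_apply] at h1
  have h3 : Var[φ; ν] / n ≤ (∫ x, φ x ^ 2 ∂ν) / n :=
    div_le_div_of_nonneg_right h2 (Nat.cast_nonneg n)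
  linarith

end EmpiricalMean

/-! ### Resampling and mutation -/

section Resample

variable {E : Type*} [MeasurableSpace E] {n : ℕ} {h : E → ℝ} {M : Kernel E E}

theorem resampleMutate_eq (h : E → ℝ) (M : Kernel E E) (x : Fin n → E) :
    resampleMutate h M x = ∑ k, ENNReal.ofReal (h (x k) / ∑ l, h (x l)) • M (x k) := by
  ext s hs
  have hM : Measurable fun a => M a s := M.measurable_coe hs
  rw [resampleMutate, Measure.bind_apply hs M.aemeasurable, lintegral_finsetSum_measure]
  simp [lintegral_smul_measure, lintegral_dirac' _ hM]

theorem isProbabilityMeasure_resampleMutate [IsMarkovKernel M] (hn : n ≠ 0) (hh : ∀ x, 0 < h x)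
    (x : Fin n → E) : IsProbabilityMeasure (resampleMutate h M x) := by
  have hS := sum_pos_of_fin hn hh x
  refine ⟨?_⟩
  rw [resampleMutate_eq]
  simp only [Measure.coe_finsetSum, Finset.sum_apply, Measure.smul_apply, measure_univ,
    smul_eq_mul, mul_one]
  rw [← ENNReal.ofReal_sum_of_nonneg fun k _ => div_nonneg (hh _).le hS.le, ← Finset.sum_div,
    div_self hS.ne', ENNReal.ofReal_one]

/-- The source of unbiasedness: the factor by which the normalizing constant is updated is
proportional to the sum of weights dividing the resampling probabilities, so the random denominator
disappears. -/
theorem empMean_mul_integral_resampleMutate [IsMarkovKernel M] (hn : n ≠ 0) (hh : ∀ x, 0 < h x)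
    {φ : E → ℝ} (hφ : BddMeas φ) (x : Fin n → E) :
    empMean h x * ∫ y, φ y ∂(resampleMutate h M x) =
      empMean (fun y => h y * ∫ z, φ z ∂(M y)) x := by
  have hS := sum_pos_of_fin hn hh x
  rw [resampleMutate_eq, integral_finsetSum_measure fun k _ =>
    (hφ.integrable (M (x k))).smul_measure ENNReal.ofReal_ne_top]
  simp only [integral_smul_measure, smul_eq_mul, empMean]
  rw [Finset.mul_sum, Finset.sum_div (f := fun k => h (x k) * ∫ z, φ z ∂(M (x k)))]
  refine Finset.sum_congr rfl fun k _ => ?_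
  rw [ENNReal.toReal_ofReal (div_nonneg (hh _).le hS.le)]
  field_simp

theorem measurable_resampleMutate (hh : Measurable h) :
    Measurable fun x : Fin n → E => resampleMutate h M x := by
  refine Measure.measurable_of_measurable_coe _ fun s hs => ?_
  have hM : Measurable fun a => M a s := M.measurable_coe hs
  simp only [resampleMutate_eq, Measure.coe_finsetSum, Finset.sum_apply, Measure.smul_apply,
    smul_eq_mul]
  fun_prop

/-- One step of the sampler, from the normalizing constant estimate and the particles. -/
def smcStep (n : ℕ) (h : E → ℝ) (M : Kernel E E) (s : ℝ × (Fin n → E)) :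
    Measure (ℝ × (Fin n → E)) :=
  (Measure.pi fun _ : Fin n => resampleMutate h M s.2).map fun x => (s.1 * empMean h s.2, x)

/-- Makes the step a genuine kernel, so that integrals against `Measure.bind` can be iterated. -/
theorem measurable_smcStep [IsMarkovKernel M] (hm : Measurable h) (hh : ∀ x, 0 < h x) :
    Measurable (smcStep n h M) := by
  have hp : ∀ (s : ℝ × (Fin n → E)) (_ : Fin n), IsProbabilityMeasure (resampleMutate h M s.2) :=
    -- An index `i : Fin n` itself witnesses `n ≠ 0`. The case `n = 0` is kept because indices that
    -- are never drawn have samplers without particles.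
    fun s i => isProbabilityMeasure_resampleMutate i.pos.ne' hh s.2
  have hpi := measurable_pi_const ((measurable_resampleMutate (M := M) hm).comp
    (measurable_snd (α := ℝ) (β := Fin n → E))) hp
  have hP (s : ℝ × (Fin n → E)) :
      IsProbabilityMeasure (Measure.pi fun _ : Fin n => resampleMutate h M s.2) :=
    @Measure.pi.instIsProbabilityMeasure _ _ _ _ (fun _ => resampleMutate h M s.2) (hp s)
  refine Measure.measurable_of_measurable_coe _ fun t ht => ?_
  have he := measurable_empMean (n := n) hm
  have key : ∀ s : ℝ × (Fin n → E), smcStep n h M s t =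
      (Measure.pi fun _ : Fin n => resampleMutate h M s.2)
        (Prod.mk s ⁻¹' {q : (ℝ × (Fin n → E)) × (Fin n → E) |
          (q.1.1 * empMean h q.1.2, q.2) ∈ t}) := by
    intro s
    rw [smcStep, Measure.map_apply (by fun_prop) ht]
    rfl
  simp_rw [key]
  let κ : Kernel (ℝ × (Fin n → E)) (Fin n → E) := ⟨_, hpi⟩
  have : IsMarkovKernel κ := ⟨hP⟩
  refine Kernel.measurable_kernel_prodMk_left (κ := κ) ?_
  have : Measurable fun q : (ℝ × (Fin n → E)) × (Fin n → E) =>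
      (q.1.1 * empMean h q.1.2, q.2) := by fun_prop
  exact this ht

theorem isProbabilityMeasure_smcStep [IsMarkovKernel M] (hm : Measurable h) (hh : ∀ x, 0 < h x)
    (s : ℝ × (Fin n → E)) : IsProbabilityMeasure (smcStep n h M s) := by
  have hp : ∀ _ : Fin n, IsProbabilityMeasure (resampleMutate h M s.2) :=
    fun i => isProbabilityMeasure_resampleMutate i.pos.ne' hh s.2
  have := @Measure.pi.instIsProbabilityMeasure _ _ _ _ (fun _ => resampleMutate h M s.2) hp
  exact Measure.isProbabilityMeasure_map (by fun_prop)

theorem ae_smcStep_fst (s : ℝ × (Fin n → E)) :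
    ∀ᵐ z ∂(smcStep n h M s), z.1 = s.1 * empMean h s.2 := by
  rw [smcStep, ae_map_iff (by fun_prop) (measurableSet_eq_fun measurable_fst measurable_const)]
  exact ae_of_all _ fun _ => rfl

variable [IsMarkovKernel M]

theorem integral_smcStep (hn : n ≠ 0) (hh : ∀ x, 0 < h x) {φ : E → ℝ}
    (hφ : BddMeas φ) (s : ℝ × (Fin n → E)) :
    ∫ z, z.1 * empMean φ z.2 ∂(smcStep n h M s) =
      s.1 * empMean (fun y => h y * ∫ z, φ z ∂(M y)) s.2 := by
  have hφ' := measurable_empMean (n := n) hφ.1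
  have := isProbabilityMeasure_resampleMutate (M := M) hn hh s.2
  rw [smcStep, integral_map (by fun_prop) (by fun_prop)]
  simp only
  rw [integral_const_mul, integral_empMean hn (hφ.integrable _), mul_assoc,
    empMean_mul_integral_resampleMutate hn hh hφ]

/-- The new particles are conditionally i.i.d., so the second moment is the squared conditional mean
plus a variance over `n`. Of the two factors `empMean h` in the variance term, one cancels the
resampling denominator for `φ²` and the other remains. -/
theorem integral_sq_smcStep_le (hn : n ≠ 0) (hh : ∀ x, 0 < h x) {φ : E → ℝ}
    (hφ : BddMeas φ) (s : ℝ × (Fin n → E)) :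
    ∫ z, (z.1 * empMean φ z.2) ^ 2 ∂(smcStep n h M s) ≤
      (s.1 * empMean (fun y => h y * ∫ z, φ z ∂(M y)) s.2) ^ 2 +
        (s.1 * empMean h s.2) * (s.1 * empMean (fun y => h y * ∫ z, φ z ^ 2 ∂(M y)) s.2) / n := by
  have hφ' := measurable_empMean (n := n) hφ.1
  have := isProbabilityMeasure_resampleMutate (M := M) hn hh s.2
  rw [smcStep, integral_map (by fun_prop) (by fun_prop)]
  simp only [mul_pow]
  rw [integral_const_mul, ← empMean_mul_integral_resampleMutate hn hh hφ,
    ← empMean_mul_integral_resampleMutate hn hh hφ.sq]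
  refine (mul_le_mul_of_nonneg_left (integral_sq_empMean_le hn (hφ.memLp _))
    (by positivity)).trans_eq ?_
  ring

end Resample

/-! ### Moments of the sequential Monte Carlo sampler -/

section SamplerMoments

variable {E : Type*} [MeasurableSpace E]

/-- Positive bounded ratios and Markov kernels leaving the intermediate distributions invariant. -/
structure IsBoundedSampler (μ : Measure E) (H : ℕ → E → ℝ) (M : ℕ → Kernel E E) (J : ℕ)
    (C : ℝ) : Prop where
  measurable_H : ∀ j, Measurable (H j)
  H_pos : ∀ j < J, ∀ x, 0 < H j x
  H_le : ∀ j < J, ∀ x, H j x ≤ C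
  markov : ∀ j, IsMarkovKernel (M j)
  prob : IsProbabilityMeasure (intermediate μ H 1)
  invariant : ∀ j, 2 ≤ j → j ≤ J → (M j).Invariant (normalized (intermediate μ H j))

/-- The factor in the bound on the variance of the sampler after `j + 1` stages. -/
def momentConst (C : ℝ) : ℕ → ℝ
  | 0 => 1
  | j + 1 => C ^ (j + 1) + C * momentConst C j

theorem momentConst_nonneg {C : ℝ} (hC : 0 ≤ C) (j : ℕ) : 0 ≤ momentConst C j := by
  induction j with
  | zero => exact zero_le_one
  | succ j ih => exact add_nonneg (by positivity) (mul_nonneg hC ih)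

variable {μ : Measure E} {H : ℕ → E → ℝ} {M : ℕ → Kernel E E} {J : ℕ} {C : ℝ}

theorem integral_intermediate_succ (hm : Measurable (H J)) (h0 : ∀ x, 0 ≤ H J x) (g : E → ℝ) :
    ∫ x, g x ∂(intermediate μ H (J + 1)) = ∫ x, H J x * g x ∂(intermediate μ H J) := by
  rw [intermediate, integral_withDensity_eq_integral_toReal_smul hm.ennreal_ofReal
    (ae_of_all _ fun _ => ENNReal.ofReal_lt_top)]
  simp only [ENNReal.toReal_ofReal (h0 _), smul_eq_mul]

theorem isFiniteMeasure_intermediate (hs : IsBoundedSampler μ H M J C) {j : ℕ} (hj : j < J) :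
    IsFiniteMeasure (intermediate μ H (j + 1)) := by
  induction j with
  | zero =>
    have := hs.prob
    infer_instance
  | succ j ih =>
    have := ih (by omega)
    refine isFiniteMeasure_withDensity (ne_of_lt ?_)
    calc ∫⁻ x, ENNReal.ofReal (H (j + 1) x) ∂(intermediate μ H (j + 1))
        ≤ ∫⁻ _, ENNReal.ofReal C ∂(intermediate μ H (j + 1)) :=
          lintegral_mono fun x => ENNReal.ofReal_le_ofReal (hs.H_le _ hj x)
      _ < ⊤ := by
          rw [lintegral_const]
          exact ENNReal.mul_lt_top ENNReal.ofReal_lt_top (measure_lt_top _ _)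

/-- Invariance passes from the normalized to the unnormalized measure by cancelling the total mass.
-/
theorem bind_intermediate (hs : IsBoundedSampler μ H M J C) {j : ℕ} (hj : j + 2 ≤ J) :
    (intermediate μ H (j + 2)).bind (M (j + 2)) = intermediate μ H (j + 2) := by
  have := isFiniteMeasure_intermediate hs (j := j + 1) (by omega)
  have h := (hs.invariant (j + 2) (by omega) hj).def
  set F := intermediate μ H (j + 2)
  -- For zero mass the normalizing factor is `⊤` and cannot be cancelled.
  by_cases h0 : F = 0
  · simp [h0]
  ext t ht
  have h1 := congrArg (fun ν : Measure E => ν t) h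
  simp only [normalized] at h1
  rw [Measure.bind_apply ht (M _).aemeasurable, lintegral_smul_measure, Measure.smul_apply,
    ← Measure.bind_apply ht (M _).aemeasurable, smul_eq_mul, smul_eq_mul] at h1
  exact (ENNReal.mul_right_inj (ENNReal.inv_ne_zero.2 (measure_ne_top _ _))
    (ENNReal.inv_ne_top.2 (Measure.measure_univ_ne_zero.2 h0))).1 h1

/-- The factor `H` advances the measure by one stage and invariance removes the kernel. This is the
step of the unbiasedness induction. -/
theorem integral_mul_kernel (hs : IsBoundedSampler μ H M J C) {j : ℕ} (hj : j + 2 ≤ J)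
    {φ : E → ℝ} (hφ : BddMeas φ) :
    ∫ x, H (j + 1) x * ∫ y, φ y ∂(M (j + 2) x) ∂(intermediate μ H (j + 1)) =
      ∫ x, φ x ∂(intermediate μ H (j + 2)) := by
  have := isFiniteMeasure_intermediate hs (j := j + 1) (by omega)
  rw [← integral_intermediate_succ (J := j + 1) (hs.measurable_H _)
    fun x => (hs.H_pos _ (by omega) x).le]
  have hb := bind_intermediate hs hj
  conv_rhs => rw [← hb]
  rw [integral_bind_kernel]
  rw [hb]
  exact hφ.integrable _

theorem bddMeas_H (hs : IsBoundedSampler μ H M J C) {j : ℕ} (hj : j < J) : BddMeas (H j) :=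
  ⟨hs.measurable_H j, C, fun x => by
    rw [abs_of_pos (hs.H_pos j hj x)]; exact hs.H_le j hj x⟩

theorem bddMeas_mul_kernel (hs : IsBoundedSampler μ H M J C) {j : ℕ} (hj : j < J) (k : ℕ)
    {φ : E → ℝ} (hφ : BddMeas φ) : BddMeas fun x => H j x * ∫ y, φ y ∂(M k x) :=
  have := hs.markov k
  (bddMeas_H hs hj).mul (hφ.integral_kernel (M k))

/-- The transition kernel of the sampler. -/
def smcKernel (n : ℕ) {h : E → ℝ} (κ : Kernel E E) [IsMarkovKernel κ] (hm : Measurable h)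
    (hh : ∀ x, 0 < h x) : Kernel (ℝ × (Fin n → E)) (ℝ × (Fin n → E)) :=
  ⟨smcStep n h κ, measurable_smcStep hm hh⟩

instance (n : ℕ) {h : E → ℝ} (κ : Kernel E E) [IsMarkovKernel κ] (hm : Measurable h)
    (hh : ∀ x, 0 < h x) : IsMarkovKernel (smcKernel n κ hm hh) :=
  ⟨fun s => isProbabilityMeasure_smcStep hm hh s⟩

theorem smcLaw_succ (n j : ℕ) [IsMarkovKernel (M (j + 2))] (hm : Measurable (H (j + 1)))
    (hh : ∀ x, 0 < H (j + 1) x) :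
    smcLaw μ H M n (j + 1) = (smcLaw μ H M n j).bind (smcKernel n (M (j + 2)) hm hh) := rfl

theorem isProbabilityMeasure_smcLaw (hs : IsBoundedSampler μ H M J C) (n : ℕ) {j : ℕ}
    (hj : j < J) : IsProbabilityMeasure (smcLaw μ H M n j) := by
  induction j with
  | zero =>
    have := hs.prob
    exact Measure.isProbabilityMeasure_map (by fun_prop)
  | succ j ih =>
    have := ih (by omega)
    have := hs.markov (j + 2)
    rw [smcLaw_succ n j (hs.measurable_H _) (hs.H_pos _ hj)]
    infer_instance

/-- The first component is a product of `j` empirical means of ratios in `(0, C]`, or zero means if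
there are no particles. -/
theorem ae_smcLaw_fst_mem (hs : IsBoundedSampler μ H M J C) (hC : 0 ≤ C) (n : ℕ) {j : ℕ}
    (hj : j < J) : ∀ᵐ z ∂(smcLaw μ H M n j), z.1 ∈ Set.Icc 0 (C ^ j) := by
  induction j with
  | zero =>
    rw [smcLaw, ae_map_iff (by fun_prop) (measurable_fst measurableSet_Icc)]
    simp
  | succ j ih =>
    have := hs.markov (j + 2)
    have hp := hs.H_pos _ hj
    rw [smcLaw_succ n j (hs.measurable_H _) hp]
    refine Measure.ae_comp_of_ae_ae (measurable_fst measurableSet_Icc) ?_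
    filter_upwards [ih (by omega)] with s hs1
    filter_upwards [ae_smcStep_fst s] with z hz
    have h1 := abs_empMean_le hC
      (fun x => (abs_of_pos (hp x)).trans_le (hs.H_le _ hj x)) s.2
    have h0 := empMean_nonneg (fun x => (hp x).le) s.2
    rw [hz, pow_succ]
    exact ⟨mul_nonneg hs1.1 h0,
      mul_le_mul hs1.2 ((le_abs_self _).trans h1) h0 (by positivity)⟩

theorem memLp_smcLaw (hs : IsBoundedSampler μ H M J C) (hC : 0 ≤ C) (n : ℕ) {j : ℕ}
    (hj : j < J) {φ : E → ℝ} (hφ : BddMeas φ) :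
    MemLp (fun z => z.1 * empMean φ z.2) 2 (smcLaw μ H M n j) := by
  have := isProbabilityMeasure_smcLaw hs n hj
  obtain ⟨hφm, B, hB⟩ := hφ
  have hm := measurable_empMean (n := n) hφm
  refine .of_bound (by fun_prop) (C ^ j * max B 0) ?_
  filter_upwards [ae_smcLaw_fst_mem hs hC n hj] with z hz
  rw [norm_mul, Real.norm_of_nonneg hz.1]
  exact mul_le_mul hz.2
    (abs_empMean_le (le_max_right _ _) (fun x => (hB x).trans (le_max_left _ _)) _)
    (norm_nonneg _) (by positivity)

/-- The sampler is unbiased. -/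
theorem integral_smcLaw (hs : IsBoundedSampler μ H M J C) (hC : 0 ≤ C) {n : ℕ} (hn : n ≠ 0) {j : ℕ}
    (hj : j < J) {φ : E → ℝ} (hφ : BddMeas φ) :
    ∫ z, z.1 * empMean φ z.2 ∂(smcLaw μ H M n j) = ∫ x, φ x ∂(intermediate μ H (j + 1)) := by
  induction j generalizing φ with
  | zero =>
    have := hs.prob
    have hm := measurable_empMean (n := n) hφ.1
    rw [smcLaw, integral_map (by fun_prop) (by fun_prop)]
    simpa using integral_empMean hn (hφ.integrable (intermediate μ H 1))
  | succ j ih =>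
    have := hs.markov (j + 2)
    have hp := hs.H_pos _ hj
    have := isProbabilityMeasure_smcLaw hs n hj
    have hint := (memLp_smcLaw hs hC n hj hφ).integrable one_le_two
    rw [smcLaw_succ n j (hs.measurable_H _) hp] at hint ⊢
    rw [integral_bind_kernel hint, ← integral_mul_kernel hs hj hφ,
      ← ih (by omega) (bddMeas_mul_kernel hs hj (j + 2) hφ)]
    exact integral_congr_ae (ae_of_all _ fun s => integral_smcStep hn hp hφ s)

/-- Jensen for the kernel, with one of the two factors `H` bounded by `C`. It keeps the second
moment of the backward-propagated test function comparable to that of `φ`. -/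
theorem integral_sq_mul_kernel_le (hs : IsBoundedSampler μ H M J C) {j : ℕ} (hj : j + 2 ≤ J)
    {φ : E → ℝ} (hφ : BddMeas φ) :
    ∫ x, (H (j + 1) x * ∫ y, φ y ∂(M (j + 2) x)) ^ 2 ∂(intermediate μ H (j + 1)) ≤
      C * ∫ x, φ x ^ 2 ∂(intermediate μ H (j + 2)) := by
  have := isFiniteMeasure_intermediate hs (j := j) (by omega)
  have := hs.markov (j + 2)
  rw [← integral_mul_kernel hs hj hφ.sq, ← integral_const_mul]
  refine integral_mono ((bddMeas_mul_kernel hs hj _ hφ).sq.integrable _)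
    (((bddMeas_mul_kernel hs hj _ hφ.sq).integrable _).const_mul C) fun x => ?_
  have h0 := hs.H_pos _ hj x
  have h1 := sq_integral_le (hφ.memLp (M (j + 2) x))
  have h2 := hs.H_le _ hj x
  have hC := h0.le.trans h2
  have h3 : 0 ≤ ∫ y, φ y ^ 2 ∂(M (j + 2) x) := integral_nonneg fun y => sq_nonneg _
  calc (H (j + 1) x * ∫ y, φ y ∂(M (j + 2) x)) ^ 2
      = H (j + 1) x * (H (j + 1) x * (∫ y, φ y ∂(M (j + 2) x)) ^ 2) := by ring
    _ ≤ C * (H (j + 1) x * ∫ y, φ y ^ 2 ∂(M (j + 2) x)) := by gcongr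

/-- The second moment of the sampler. -/
theorem integral_sq_smcLaw_le (hs : IsBoundedSampler μ H M J C) (hC : 0 ≤ C) {n : ℕ} (hn : n ≠ 0)
    {j : ℕ} (hj : j < J) {φ : E → ℝ} (hφ : BddMeas φ) :
    ∫ z, (z.1 * empMean φ z.2) ^ 2 ∂(smcLaw μ H M n j) ≤
      (∫ x, φ x ∂(intermediate μ H (j + 1))) ^ 2 +
        momentConst C j * (∫ x, φ x ^ 2 ∂(intermediate μ H (j + 1))) / n := by
  induction j generalizing φ with
  | zero =>
    have := hs.prob
    have hm := measurable_empMean (n := n) hφ.1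
    rw [smcLaw, integral_map (by fun_prop) (by fun_prop)]
    simpa [momentConst] using integral_sq_empMean_le hn (hφ.memLp (intermediate μ H 1))
  | succ j ih =>
    have := hs.markov (j + 2)
    have hp := hs.H_pos _ hj
    have hj' : j < J := by omega
    have := isProbabilityMeasure_smcLaw hs n hj'
    have hψ := bddMeas_mul_kernel hs hj (j + 2) hφ
    have hψ2 := bddMeas_mul_kernel hs hj (j + 2) hφ.sq
    have hint := (memLp_smcLaw hs hC n hj hφ).integrable_sq
    have h1 := (memLp_smcLaw hs hC n hj' hψ).integrable_sq
    have h2 := ((memLp_smcLaw hs hC n hj' hψ2).integrable one_le_two).const_mul (C ^ (j + 1) / n)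
    have hmono : ∫ s, (∫ z, (z.1 * empMean φ z.2) ^ 2 ∂(smcStep n (H (j + 1)) (M (j + 2)) s))
        ∂(smcLaw μ H M n j) ≤
        ∫ s, ((s.1 * empMean (fun y => H (j + 1) y * ∫ z, φ z ∂(M (j + 2) y)) s.2) ^ 2 +
          C ^ (j + 1) / n *
            (s.1 * empMean (fun y => H (j + 1) y * ∫ z, φ z ^ 2 ∂(M (j + 2) y)) s.2))
        ∂(smcLaw μ H M n j) := by
      refine integral_mono_of_nonneg (ae_of_all _ fun s => integral_nonneg fun z => sq_nonneg _)
        (h1.add h2) ?_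
      filter_upwards [ae_smcLaw_fst_mem hs hC n hj'] with s hs1
      refine (integral_sq_smcStep_le hn hp hφ s).trans ?_
      have h4 := (le_abs_self _).trans (abs_empMean_le hC
        (fun x => (abs_of_pos (hp x)).trans_le (hs.H_le _ hj x)) s.2)
      have h5 := empMean_nonneg (fun x => (hp x).le) s.2
      have h6 : 0 ≤ s.1 * empMean (fun y => H (j + 1) y * ∫ z, φ z ^ 2 ∂(M (j + 2) y)) s.2 :=
        mul_nonneg hs1.1 (empMean_nonneg
          (fun x => mul_nonneg (hp x).le (integral_nonneg fun z => sq_nonneg _)) s.2)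
      -- The updated normalizing constant is bounded, leaving a term linear in the sampler, whose
      -- mean is known exactly by unbiasedness.
      have h7 : s.1 * empMean (H (j + 1)) s.2 ≤ C ^ (j + 1) := by
        rw [pow_succ]
        exact mul_le_mul hs1.2 h4 h5 (by positivity)
      rw [div_mul_eq_mul_div]
      gcongr
    rw [integral_add h1 h2, integral_const_mul,
      integral_smcLaw hs hC hn hj' hψ2, integral_mul_kernel hs hj hφ.sq] at hmono
    -- The induction hypothesis is applied to `H · Mφ`, whose integral at the previous stage equals
    -- that of `φ` at this one; the squared mean thus carries over without loss.
    have h8 := ih hj' hψ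
    rw [integral_mul_kernel hs hj hφ] at h8
    rw [smcLaw_succ n j (hs.measurable_H _) hp] at hint ⊢
    rw [integral_bind_kernel hint]
    refine hmono.trans ((add_le_add_left h8 _).trans ?_)
    have h9 := mul_le_mul_of_nonneg_left (integral_sq_mul_kernel_le hs hj hφ)
      (momentConst_nonneg hC j)
    have h10 := div_le_div_of_nonneg_right h9 (Nat.cast_nonneg (α := ℝ) n)
    calc _ ≤ (∫ x, φ x ∂(intermediate μ H (j + 2))) ^ 2 +
          momentConst C j * (C * ∫ x, φ x ^ 2 ∂(intermediate μ H (j + 2))) / n +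
          C ^ (j + 1) / n * ∫ x, φ x ^ 2 ∂(intermediate μ H (j + 2)) := by gcongr
      _ = _ := by rw [momentConst]; ring

/-- The variance of the sampler. -/
theorem variance_smcLaw_le (hs : IsBoundedSampler μ H M J C) (hC : 0 ≤ C) {n : ℕ} (hn : n ≠ 0)
    {j : ℕ} (hj : j < J) {φ : E → ℝ} (hφ : BddMeas φ) :
    Var[fun z => z.1 * empMean φ z.2; smcLaw μ H M n j] ≤
      momentConst C j * (∫ x, φ x ^ 2 ∂(intermediate μ H (j + 1))) / n := by
  have := isProbabilityMeasure_smcLaw hs n hj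
  have h1 := variance_eq_sub (memLp_smcLaw hs hC n hj hφ)
  have h2 := integral_sq_smcLaw_le hs hC hn hj hφ
  simp only [Pi.pow_apply] at h1
  rw [h1, integral_smcLaw hs hC hn hj hφ]
  linarith

end SamplerMoments

/-! ### The approximate couplings -/

section Coupling

variable {D : ℕ} {X : Type*} {Lα ζα : MultiIndex D → X → ℝ}

theorem lowerLike_nonneg (hLα0 : ∀ α x, 0 ≤ Lα α x) (α : MultiIndex D) (S : Finset (Fin D))
    (x : X) : 0 ≤ lowerLike Lα α S x := by
  unfold lowerLike
  split_ifs
  exacts [hLα0 _ _, le_rfl]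

theorem lowerLike_le_coupledLike (α : MultiIndex D) (S : Finset (Fin D)) (x : Coupled D X) :
    lowerLike Lα α S (x S) ≤ coupledLike Lα α x :=
  Finset.le_sup' (fun S => lowerLike Lα α S (x S)) (Finset.mem_univ S)

theorem coupledLike_nonneg (hLα0 : ∀ α x, 0 ≤ Lα α x) (α : MultiIndex D) (x : Coupled D X) :
    0 ≤ coupledLike Lα α x :=
  (lowerLike_nonneg hLα0 α ∅ (x ∅)).trans (lowerLike_le_coupledLike α ∅ x)

theorem le_coupledLike_diag (α : MultiIndex D) (x : X) :
    Lα α x ≤ coupledLike Lα α fun _ => x := by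
  refine le_trans (le_of_eq ?_) (lowerLike_le_coupledLike α ∅ fun _ => x)
  have h : lower α ∅ = α := by funext j; simp [lower]
  simp [lowerLike, Admissible, h]

/-- On the diagonal the common denominator of the weights cancels, leaving the signed sum over
subsets. -/
theorem coupledLike_mul_psi_diag {α : MultiIndex D} {x : X}
    (h : coupledLike Lα α (fun _ => x) ≠ 0) :
    coupledLike Lα α (fun _ => x) * psi Lα ζα α (fun _ => x) =
      mixedDiff (fun α' => Lα α' x * ζα α' x) α := by
  rw [psi, mixedDiff_eq_sum, Finset.mul_sum]
  refine Finset.sum_congr rfl fun S _ => ?_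
  rw [lowerLike]
  split_ifs
  · field_simp
  · simp

variable [MeasurableSpace X]

theorem measurable_lowerLike (hLα : ∀ α, Measurable (Lα α)) (α : MultiIndex D)
    (S : Finset (Fin D)) : Measurable (lowerLike Lα α S) := by
  unfold lowerLike
  split_ifs
  exacts [hLα _, measurable_const]

theorem measurable_coupledLike (hLα : ∀ α, Measurable (Lα α)) (α : MultiIndex D) :
    Measurable (coupledLike Lα α) := by
  have h := Finset.measurable_sup' (s := Finset.univ) Finset.univ_nonempty
    (f := fun (S : Finset (Fin D)) (x : Coupled D X) => lowerLike Lα α S (x S))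
    fun S _ => (measurable_lowerLike hLα α S).comp (measurable_pi_apply S)
  convert h using 1
  funext x
  rw [coupledLike, Finset.sup'_apply]

theorem bddMeas_psi (hLα : ∀ α, Measurable (Lα α)) (hLα0 : ∀ α x, 0 ≤ Lα α x)
    (hζα : ∀ α, Measurable (ζα α)) (hζαb : ∀ α, ∃ B, ∀ x, |ζα α x| ≤ B) (α : MultiIndex D) :
    BddMeas (psi Lα ζα α) := by
  refine BddMeas.finsetSum _ fun S _ => BddMeas.mul (BddMeas.mul ?_ ?_) ?_
  · exact ⟨measurable_const, _, fun _ => le_rfl⟩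
  -- Each weight is at most 1 since the denominator is the maximum of the numerators; the convention
  -- `0 / 0 = 0` is compatible with this.
  · refine ⟨((measurable_lowerLike hLα α S).comp (measurable_pi_apply S)).div
      (measurable_coupledLike hLα α), 1, fun x => ?_⟩
    have h0 := lowerLike_nonneg hLα0 α S (x S)
    have h1 := coupledLike_nonneg hLα0 α x
    rw [abs_of_nonneg (div_nonneg h0 h1)]
    exact div_le_one_of_le₀ (lowerLike_le_coupledLike α S x) h1
  · exact BddMeas.comp (φ := ζα (lower α S)) ⟨hζα _, hζαb _⟩ (measurable_pi_apply S)

variable {π₀ : Measure X}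

theorem measurable_diag : Measurable fun (x : X) (_ : Finset (Fin D)) => x :=
  measurable_pi_lambda _ fun _ => measurable_id

theorem integral_approxCoupling (hLα : ∀ α, Measurable (Lα α)) (hLα0 : ∀ α x, 0 ≤ Lα α x)
    (α : MultiIndex D) {φ : Coupled D X → ℝ} (hφ : Measurable φ) :
    ∫ x, φ x ∂(approxCoupling π₀ Lα α) =
      ∫ x, coupledLike Lα α (fun _ => x) * φ (fun _ => x) ∂π₀ := by
  have hm := measurable_coupledLike hLα α
  rw [approxCoupling, integral_withDensity_eq_integral_toReal_smul hm.ennreal_ofReal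
    (ae_of_all _ fun _ => ENNReal.ofReal_lt_top)]
  simp only [ENNReal.toReal_ofReal (coupledLike_nonneg hLα0 α _), smul_eq_mul]
  rw [priorCoupling, integral_map measurable_diag.aemeasurable (by fun_prop)]

theorem intermediate_eq_withDensity {E : Type*} [MeasurableSpace E] (μ : Measure E)
    {H : ℕ → E → ℝ} (hm : ∀ j, Measurable (H j)) (j : ℕ) :
    intermediate μ H j =
      μ.withDensity fun x => ∏ i ∈ Finset.range j, ENNReal.ofReal (H i x) := by
  induction j with
  | zero => simp [intermediate]
  | succ j ih =>
    rw [intermediate, ih, ← withDensity_mul _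
      (Finset.measurable_fun_prod _ fun i _ => (hm i).ennreal_ofReal) (hm j).ennreal_ofReal]
    congr 1
    funext x
    rw [Pi.mul_apply, Finset.prod_range_succ]

/-- The constants of the uniform bounds, at the same value for all stages. -/
def BoundedRatios (s : SMCData π₀ Lα) (C : ℝ) : Prop :=
  1 ≤ C ∧ ∀ j < s.J, ∀ α x, C⁻¹ ≤ s.H α j x ∧ s.H α j x ≤ C

theorem UniformBounds.exists_boundedRatios {L : X → ℝ} {s : SMCData π₀ Lα}
    (h : UniformBounds L s) : ∃ C, BoundedRatios s C := by
  choose! B hB _ hH using h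
  -- The sum dominates the constant of every stage, and the summand 1 ensures `1 ≤ C`.
  refine ⟨1 + ∑ j ∈ Finset.range s.J, B j, le_add_of_nonneg_right (Finset.sum_nonneg
    fun j hj => (hB j (Finset.mem_range.1 hj)).le), fun j hj α x => ?_⟩
  have h1 : B j ≤ 1 + ∑ j ∈ Finset.range s.J, B j :=
    (Finset.single_le_sum (fun i hi => (hB i (Finset.mem_range.1 hi)).le)
      (Finset.mem_range.2 hj)).trans (le_add_of_nonneg_left zero_le_one)
  exact ⟨(inv_anti₀ (hB j hj) h1).trans (hH j hj α x).1.le, (hH j hj α x).2.trans h1⟩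

variable {s : SMCData π₀ Lα} {C : ℝ}

theorem BoundedRatios.isBoundedSampler (h : BoundedRatios s C) (α : MultiIndex D) :
    IsBoundedSampler (priorCoupling D π₀) (s.H α) (s.M α) s.J C where
  measurable_H := s.measurable_H α
  H_pos j hj x := (inv_pos.2 (zero_lt_one.trans_le h.1)).trans_le (h.2 j hj α x).1
  H_le j hj x := (h.2 j hj α x).2
  markov := s.markov_M α
  prob := s.isProbability_first α
  invariant := s.invariant α

variable [IsProbabilityMeasure π₀]

/-- The product of the ratios and `𝐋_α` are both densities of `F_α` with respect to `Π₀`, hence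
agree almost everywhere; each of the `J` factors lies in `[C⁻¹, C]`. -/
theorem BoundedRatios.ae_coupledLike (h : BoundedRatios s C) (hLα : ∀ α, Measurable (Lα α))
    (hLα0 : ∀ α x, 0 ≤ Lα α x) (α : MultiIndex D) :
    ∀ᵐ x ∂π₀, (C ^ s.J)⁻¹ ≤ coupledLike Lα α (fun _ => x) ∧
      coupledLike Lα α (fun _ => x) ≤ C ^ s.J := by
  have hprob : IsProbabilityMeasure (priorCoupling D π₀) :=
    Measure.isProbabilityMeasure_map measurable_diag.aemeasurable
  have hm : Measurable fun x => ∏ i ∈ Finset.range s.J, ENNReal.ofReal (s.H α i x) :=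
    Finset.measurable_fun_prod _ fun i _ => (s.measurable_H α i).ennreal_ofReal
  have hm' := (measurable_coupledLike hLα α).ennreal_ofReal
  have h1 := s.last_eq α
  rw [intermediate_eq_withDensity _ (s.measurable_H α), approxCoupling,
    withDensity_eq_iff_of_sigmaFinite hm.aemeasurable hm'.aemeasurable] at h1
  have h2 := ae_of_ae_map measurable_diag.aemeasurable h1
  have hC : 0 < C := zero_lt_one.trans_le h.1
  filter_upwards [h2] with x hx
  have hpos : ∀ i ∈ Finset.range s.J, 0 < s.H α i (fun _ => x) := fun i hi =>
    (h.isBoundedSampler α).H_pos i (Finset.mem_range.1 hi) _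
  rw [← ENNReal.ofReal_prod_of_nonneg fun i hi => (hpos i hi).le,
    ENNReal.ofReal_eq_ofReal_iff (Finset.prod_nonneg fun i hi => (hpos i hi).le)
      (coupledLike_nonneg hLα0 α _)] at hx
  rw [← hx]
  constructor
  · calc (C ^ s.J)⁻¹ = ∏ _i ∈ Finset.range s.J, C⁻¹ := by simp
      _ ≤ _ := Finset.prod_le_prod (fun i _ => (inv_pos.2 hC).le) fun i hi =>
        (h.2 i (Finset.mem_range.1 hi) α _).1
  · calc _ ≤ ∏ _i ∈ Finset.range s.J, C := Finset.prod_le_prod (fun i hi => (hpos i hi).le)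
          fun i hi => (h.2 i (Finset.mem_range.1 hi) α _).2
      _ = C ^ s.J := by simp

variable (h : BoundedRatios s C) (hLα : ∀ α, Measurable (Lα α)) (hLα0 : ∀ α x, 0 ≤ Lα α x)
  (hζα : ∀ α, Measurable (ζα α)) (hζαb : ∀ α, ∃ B, ∀ x, |ζα α x| ≤ B)

include h hLα hLα0

theorem ae_mixedDiff_eq (α : MultiIndex D) :
    ∀ᵐ x ∂π₀, coupledLike Lα α (fun _ => x) * psi Lα ζα α (fun _ => x) =
      mixedDiff (fun α' => Lα α' x * ζα α' x) α := by
  have hC : 0 < C := zero_lt_one.trans_le h.1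
  filter_upwards [h.ae_coupledLike hLα hLα0 α] with x hx
  exact coupledLike_mul_psi_diag ((inv_pos.2 (pow_pos hC _)).trans_le hx.1).ne'

include hζα hζαb

/-- Boundedness of `L_α` almost everywhere is inherited from `𝐋_α`, which dominates it on the
diagonal. -/
theorem integrable_like_mul (α : MultiIndex D) :
    Integrable (fun x => Lα α x * ζα α x) π₀ := by
  obtain ⟨B, hB⟩ := hζαb α
  refine .of_bound ((hLα α).mul (hζα α)).aestronglyMeasurable (C ^ s.J * B) ?_
  filter_upwards [h.ae_coupledLike hLα hLα0 α] with x hx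
  rw [norm_mul, Real.norm_of_nonneg (hLα0 α x)]
  exact mul_le_mul ((le_coupledLike_diag α x).trans hx.2) (hB x) (norm_nonneg _)
    (pow_nonneg (zero_le_one.trans h.1) _)

theorem memLp_mixedDiff (α : MultiIndex D) :
    MemLp (fun x => mixedDiff (fun α' => Lα α' x * ζα α' x) α) 2 π₀ := by
  obtain ⟨hψ, B, hB⟩ := bddMeas_psi hLα hLα0 hζα hζαb α
  refine MemLp.ae_eq (ae_mixedDiff_eq h hLα hLα0 α) (.of_bound
    (((measurable_coupledLike hLα α).comp measurable_diag).mul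
      (hψ.comp measurable_diag)).aestronglyMeasurable (C ^ s.J * B) ?_)
  filter_upwards [h.ae_coupledLike hLα hLα0 α] with x hx
  rw [norm_mul, Real.norm_of_nonneg (coupledLike_nonneg hLα0 α _)]
  exact mul_le_mul hx.2 (hB _) (norm_nonneg _) (pow_nonneg (zero_le_one.trans h.1) _)

theorem integral_mixedDiff (α : MultiIndex D) :
    ∫ x, mixedDiff (fun α' => Lα α' x * ζα α' x) α ∂π₀ =
      mixedDiff (fun α' => unnorm π₀ (Lα α') (ζα α')) α := by
  simp only [mixedDiff_eq_sum]
  have hi := integrable_like_mul h hLα hLα0 hζα hζαb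
  rw [integral_finsetSum]
  · refine Finset.sum_congr rfl fun S _ => ?_
    split_ifs
    · rw [integral_const_mul, unnorm]
      simp only [mul_comm]
    · simp
  · intro S _
    split_ifs
    · exact (hi _).const_mul _
    · exact integrable_zero _ _ _

theorem integral_psi (α : MultiIndex D) :
    ∫ x, psi Lα ζα α x ∂(approxCoupling π₀ Lα α) =
      mixedDiff (fun α' => unnorm π₀ (Lα α') (ζα α')) α := by
  rw [integral_approxCoupling hLα hLα0 α (bddMeas_psi hLα hLα0 hζα hζαb α).1,
    ← integral_mixedDiff h hLα hLα0 hζα hζαb]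
  exact integral_congr_ae (ae_mixedDiff_eq h hLα hLα0 α)

theorem sq_mixedDiff_unnorm_le (α : MultiIndex D) :
    mixedDiff (fun α' => unnorm π₀ (Lα α') (ζα α')) α ^ 2 ≤
      ∫ x, mixedDiff (fun α' => Lα α' x * ζα α' x) α ^ 2 ∂π₀ := by
  rw [← integral_mixedDiff h hLα hLα0 hζα hζαb]
  exact sq_integral_le (memLp_mixedDiff h hLα hLα0 hζα hζαb α)

/-- On the diagonal `𝐋_α ψ² = (𝐋_α ψ)² / 𝐋_α`, and the lower bound on `𝐋_α` controls the division.
-/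
theorem integral_sq_psi_le (α : MultiIndex D) :
    ∫ x, psi Lα ζα α x ^ 2 ∂(approxCoupling π₀ Lα α) ≤
      C ^ s.J * ∫ x, mixedDiff (fun α' => Lα α' x * ζα α' x) α ^ 2 ∂π₀ := by
  have hC : 0 < C := zero_lt_one.trans_le h.1
  rw [integral_approxCoupling hLα hLα0 α (bddMeas_psi hLα hLα0 hζα hζαb α).sq.1,
    ← integral_const_mul]
  refine integral_mono_of_nonneg
    (ae_of_all _ fun x => mul_nonneg (coupledLike_nonneg hLα0 α _) (sq_nonneg _))
    ((memLp_mixedDiff h hLα hLα0 hζα hζαb α).integrable_sq.const_mul _) ?_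
  filter_upwards [h.ae_coupledLike hLα hLα0 α,
    ae_mixedDiff_eq (ζα := ζα) h hLα hLα0 α] with x hx hx'
  have h0 := coupledLike_nonneg hLα0 α fun _ => x
  have h1 : 1 ≤ C ^ s.J * coupledLike Lα α fun _ => x := by
    rw [← inv_mul_le_iff₀ (pow_pos hC _), mul_one]
    exact hx.1
  rw [← hx']
  calc coupledLike Lα α (fun _ => x) * psi Lα ζα α (fun _ => x) ^ 2
      = 1 * (coupledLike Lα α (fun _ => x) * psi Lα ζα α (fun _ => x) ^ 2) := (one_mul _).symm
    _ ≤ (C ^ s.J * coupledLike Lα α fun _ => x) *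
        (coupledLike Lα α (fun _ => x) * psi Lα ζα α (fun _ => x) ^ 2) := by gcongr
    _ = _ := by ring

/-- Moments of the increment estimators. -/
theorem exists_moments_estimatorLaw {β : Fin D → ℝ} (hV : VarianceRate π₀ Lα ζα β) :
    ∃ K : ℝ, 0 < K ∧ ∀ α,
      mixedDiff (fun α' => unnorm π₀ (Lα α') (ζα α')) α ^ 2 ≤ K * rate β α ∧
      ∀ n, IsProbabilityMeasure (s.estimatorLaw (psi Lα ζα α) α n) ∧
        MemLp id 2 (s.estimatorLaw (psi Lα ζα α) α n) ∧ (n ≠ 0 →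
        ∫ y, y ∂(s.estimatorLaw (psi Lα ζα α) α n) =
          mixedDiff (fun α' => unnorm π₀ (Lα α') (ζα α')) α ∧
        Var[id; s.estimatorLaw (psi Lα ζα α) α n] ≤ K * rate β α / n) := by
  obtain ⟨V, hV0, hV⟩ := hV
  have hC : 0 < C := zero_lt_one.trans_le h.1
  have hm0 := momentConst_nonneg hC.le (s.J - 1)
  -- `smcLaw` at index `0` already targets `F_1`, so `F_J` is reached at index `J - 1`.
  have hJ : s.J - 1 < s.J := Nat.sub_lt s.one_le_J Nat.one_pos
  have hJ1 : s.J - 1 + 1 = s.J := Nat.sub_add_cancel s.one_le_J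
  -- The summand `V` serves the squared mean, the other one the variance.
  refine ⟨V + momentConst C (s.J - 1) * (C ^ s.J * V), by positivity, fun α => ⟨?_, fun n => ?_⟩⟩
  · have h1 : 0 ≤ momentConst C (s.J - 1) * (C ^ s.J * V) * rate β α :=
      mul_nonneg (by positivity) (rate_pos β α).le
    linarith [(sq_mixedDiff_unnorm_le h hLα hLα0 hζα hζαb α).trans (hV α)]
  have hb := h.isBoundedSampler α
  have hψ := bddMeas_psi hLα hLα0 hζα hζαb α
  have hprob := isProbabilityMeasure_smcLaw hb n hJ
  have hmeas : Measurable fun z : ℝ × (Fin n → Coupled D X) =>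
      z.1 * empMean (psi Lα ζα α) z.2 :=
    measurable_fst.mul ((measurable_empMean hψ.1).comp measurable_snd)
  refine ⟨Measure.isProbabilityMeasure_map hmeas.aemeasurable, ?_, fun hn => ⟨?_, ?_⟩⟩
  · rw [SMCData.estimatorLaw, memLp_map_measure_iff (by fun_prop) hmeas.aemeasurable]
    exact memLp_smcLaw hb hC.le n hJ hψ
  · rw [SMCData.estimatorLaw, integral_map hmeas.aemeasurable (by fun_prop),
      integral_smcLaw hb hC.le hn hJ hψ, hJ1, s.last_eq,
      integral_psi h hLα hLα0 hζα hζαb]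
  · rw [SMCData.estimatorLaw, variance_map (by fun_prop) hmeas.aemeasurable]
    refine (variance_smcLaw_le hb hC.le hn hJ hψ).trans ?_
    rw [hJ1, s.last_eq]
    refine div_le_div_of_nonneg_right ?_ (Nat.cast_nonneg n)
    have h2 : momentConst C (s.J - 1) * ∫ x, psi Lα ζα α x ^ 2 ∂(approxCoupling π₀ Lα α) ≤
        momentConst C (s.J - 1) * (C ^ s.J * (V * rate β α)) := by
      refine mul_le_mul_of_nonneg_left ?_ hm0
      refine (integral_sq_psi_le h hLα hLα0 hζα hζαb α).trans ?_
      have := hV α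
      gcongr
    have h3 := mul_pos hV0 (rate_pos β α)
    linarith

end Coupling

/-! ### Mean square errors -/

theorem integral_sub_const_sq {Ω : Type*} [MeasurableSpace Ω] {P : Measure Ω}
    [IsProbabilityMeasure P] {Y : Ω → ℝ} (hY : MemLp Y 2 P) (f : ℝ) :
    ∫ ω, (Y ω - f) ^ 2 ∂P = Var[Y; P] + (∫ ω, Y ω ∂P - f) ^ 2 := by
  have h1 := variance_eq_sub (hY.sub (memLp_const f))
  have h2 : Var[Y - fun _ => f; P] = Var[Y; P] := variance_sub_const hY.1 f
  have h3 : ∫ ω, (Y - fun _ => f : Ω → ℝ) ω ∂P = ∫ ω, Y ω ∂P - f := by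
    simp [integral_sub (hY.integrable one_le_two) (integrable_const f)]
  rw [h2, h3] at h1
  rw [h1]
  simp

theorem lintegral_ofReal_sub_const_sq {Ω : Type*} [MeasurableSpace Ω] {P : Measure Ω}
    [IsProbabilityMeasure P] {Y : Ω → ℝ} (hY : MemLp Y 2 P) (f : ℝ) :
    ∫⁻ ω, ENNReal.ofReal ((Y ω - f) ^ 2) ∂P =
      ENNReal.ofReal (Var[Y; P] + (∫ ω, Y ω ∂P - f) ^ 2) := by
  rw [← integral_sub_const_sq hY]
  exact (ofReal_integral_eq_lintegral_ofReal (hY.sub (memLp_const f)).integrable_sq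
    (ae_of_all _ fun _ => sq_nonneg _)).symm

/-- Moments of a linear combination of finitely many coordinates under a product measure. -/
theorem moments_sum_infinitePi {ι : Type*} {P : ι → Measure ℝ} [∀ i, IsProbabilityMeasure (P i)]
    (hP : ∀ i, MemLp id 2 (P i)) (t : Finset ι) (c : ι → ℝ) :
    MemLp (fun y : ι → ℝ => ∑ i ∈ t, c i * y i) 2 (Measure.infinitePi P) ∧
    ∫ y, ∑ i ∈ t, c i * y i ∂(Measure.infinitePi P) = ∑ i ∈ t, c i * ∫ y, y ∂(P i) ∧
    Var[fun y : ι → ℝ => ∑ i ∈ t, c i * y i; Measure.infinitePi P] =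
      ∑ i ∈ t, c i ^ 2 * Var[id; P i] := by
  have hmp (i : ι) := measurePreserving_eval_infinitePi P i
  have hL (i : ι) : MemLp (fun y : ι → ℝ => y i) 2 (Measure.infinitePi P) :=
    (hP i).comp_measurePreserving (hmp i)
  have hcL (i : ι) : MemLp (fun y : ι → ℝ => c i * y i) 2 (Measure.infinitePi P) :=
    (hL i).const_mul (c i)
  refine ⟨memLp_finsetSum t fun i _ => hcL i, ?_, ?_⟩
  · rw [integral_finsetSum _ fun i _ => (hcL i).integrable one_le_two]
    refine Finset.sum_congr rfl fun i _ => ?_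
    rw [integral_const_mul]
    conv_rhs => rw [← (hmp i).map_eq]
    rw [integral_map (hmp i).measurable.aemeasurable (by fun_prop)]
  · have hind : iIndepFun (fun i (y : ι → ℝ) => c i * y i) (Measure.infinitePi P) :=
      iIndepFun_infinitePi (X := fun i x => c i * x) fun i => measurable_const_mul (c i)
    have h1 := IndepFun.variance_sum (s := t) (fun i _ => hcL i)
      fun i _ j _ hij => hind.indepFun hij
    have h2 : (fun y : ι → ℝ => ∑ i ∈ t, c i * y i) = ∑ i ∈ t, fun y : ι → ℝ => c i * y i := by
      funext y
      rw [Finset.sum_apply]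
    rw [h2, h1]
    refine Finset.sum_congr rfl fun i _ => ?_
    rw [variance_const_mul]
    conv_rhs => rw [← (hmp i).map_eq]
    rw [variance_map (by fun_prop) (hmp i).measurable.aemeasurable]
    rfl

/-! ### The randomized estimator -/

section Randomized

variable {D : ℕ}

/-- Groups the draws by value, turning a sum weighted by counts into a sum over draws. -/
theorem sum_image_count_mul {m : ℕ} (Nmin : ℕ) (a : Fin m → MultiIndex D)
    (g : MultiIndex D → ℝ) :
    ∑ α ∈ Finset.univ.image a, (count Nmin a α : ℝ) * g α = Nmin * ∑ i, g (a i) := by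
  rw [← Finset.sum_fiberwise_of_maps_to (g := a) (t := Finset.univ.image a)
    (fun i _ => Finset.mem_image_of_mem a (Finset.mem_univ i)), Finset.mul_sum]
  refine Finset.sum_congr rfl fun α _ => ?_
  rw [Finset.sum_congr rfl fun i hi => by rw [(Finset.mem_filter.1 hi).2], Finset.sum_const, count]
  push_cast
  rw [nsmul_eq_mul, mul_assoc]

theorem count_ne_zero {m Nmin : ℕ} (hN : Nmin ≠ 0) {a : Fin m → MultiIndex D} {α : MultiIndex D}
    (hα : α ∈ Finset.univ.image a) : count Nmin a α ≠ 0 := by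
  obtain ⟨i, _, hi⟩ := Finset.mem_image.1 hα
  exact mul_ne_zero hN (Finset.card_ne_zero_of_mem (Finset.mem_filter.2 ⟨Finset.mem_univ i, hi⟩))

theorem rmiEstimator_eq_sum (p : PMF (MultiIndex D)) (Nmin m : ℕ) (a : Fin m → MultiIndex D)
    (y : MultiIndex D → ℝ) :
    rmiEstimator p Nmin m (a, y) = ∑ α ∈ Finset.univ.image a,
      (count Nmin a α : ℝ) / (((Nmin * m : ℕ) : ℝ) * (p α).toReal) * y α := by
  refine tsum_eq_sum fun α hα => ?_
  have h : count Nmin a α = 0 := by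
    refine mul_eq_zero_of_right _ (Finset.card_eq_zero.2 (Finset.filter_eq_empty_iff.2 ?_))
    exact fun i _ hi => hα (Finset.mem_image.2 ⟨i, Finset.mem_univ i, hi⟩)
  simp [h]

/-- Given the draws of the indices, the mean square error of the randomized estimator. -/
theorem lintegral_rmiEstimator_le {P : MultiIndex D → ℕ → Measure ℝ} {d v : MultiIndex D → ℝ}
    (hprob : ∀ α n, IsProbabilityMeasure (P α n)) (hL : ∀ α n, MemLp id 2 (P α n))
    (hmean : ∀ α n, n ≠ 0 → ∫ y, y ∂(P α n) = d α)
    (hvar : ∀ α n, n ≠ 0 → Var[id; P α n] ≤ v α / n)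
    (p : PMF (MultiIndex D)) {Nmin m : ℕ} (hN : Nmin ≠ 0) (hm : m ≠ 0)
    (a : Fin m → MultiIndex D) (f : ℝ) :
    ∫⁻ y, ENNReal.ofReal ((rmiEstimator p Nmin m (a, y) - f) ^ 2)
        ∂(Measure.infinitePi fun α => P α (count Nmin a α)) ≤
      ENNReal.ofReal (empMean (fun α => v α / (p α).toReal ^ 2) a / ((Nmin * m : ℕ) : ℝ) +
        (empMean (fun α => d α / (p α).toReal) a - f) ^ 2) := by
  have hN' : (Nmin : ℝ) ≠ 0 := Nat.cast_ne_zero.2 hN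
  have hm' : (m : ℝ) ≠ 0 := Nat.cast_ne_zero.2 hm
  set c : MultiIndex D → ℝ := fun α =>
    (count Nmin a α : ℝ) / (((Nmin * m : ℕ) : ℝ) * (p α).toReal) with hc
  obtain ⟨h1, h2, h3⟩ := moments_sum_infinitePi (P := fun α => P α (count Nmin a α))
    (fun α => hL α _) (Finset.univ.image a) c
  simp only [rmiEstimator_eq_sum]
  rw [lintegral_ofReal_sub_const_sq h1, h2, h3]
  refine ENNReal.ofReal_le_ofReal (add_le_add ?_ (le_of_eq ?_))
  -- The squared weight contains `N_α²` and the variance contributes `1 / N_α`; the remaining single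
  -- power of `N_α` makes this a sum over the draws.
  · calc ∑ α ∈ Finset.univ.image a, c α ^ 2 * Var[id; P α (count Nmin a α)]
        ≤ ∑ α ∈ Finset.univ.image a, (count Nmin a α : ℝ) *
            (v α / (p α).toReal ^ 2 / ((Nmin * m : ℕ) : ℝ) ^ 2) := by
          refine Finset.sum_le_sum fun α hα => ?_
          have h0 := count_ne_zero hN hα
          have h0' : (count Nmin a α : ℝ) ≠ 0 := Nat.cast_ne_zero.2 h0
          refine (mul_le_mul_of_nonneg_left (hvar α _ h0) (sq_nonneg _)).trans_eq ?_
          rw [hc]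
          simp only [div_pow, mul_pow]
          rw [div_mul_div_comm, pow_two (count Nmin a α : ℝ)]
          rw [mul_right_comm, mul_div_mul_right _ _ h0', mul_div_assoc, div_div, mul_comm (_ ^ 2)]
      _ = _ := by
          rw [sum_image_count_mul, empMean, ← Finset.sum_div]
          push_cast
          field_simp
  · congr 2
    rw [empMean, Finset.sum_congr rfl fun α hα => by rw [hmean α _ (count_ne_zero hN hα)]]
    have h4 : ∀ α, c α * d α =
        (count Nmin a α : ℝ) * (d α / (p α).toReal / ((Nmin * m : ℕ) : ℝ)) := fun α => by
      rw [hc, div_mul_eq_mul_div, mul_div_assoc, div_div, mul_comm ((Nmin * m : ℕ) : ℝ)]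
    simp only [h4]
    rw [sum_image_count_mul, ← Finset.sum_div]
    push_cast
    field_simp

/-- Averaging under `p` cancels one of the two factors `1 / p α`. -/
theorem lintegral_rate_div_sq (p : PMF (MultiIndex D)) (hp : ∀ α, p α ≠ 0) {K : ℝ} (hK : 0 ≤ K)
    (β : Fin D → ℝ) :
    ∫⁻ α, ENNReal.ofReal (K * rate β α / (p α).toReal ^ 2) ∂p.toMeasure =
      ENNReal.ofReal K * diagSum p β := by
  rw [lintegral_countable', diagSum, ← ENNReal.tsum_mul_left]
  refine tsum_congr fun α => ?_
  have hpos : 0 < (p α).toReal := ENNReal.toReal_pos (hp α) (p.apply_ne_top α)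
  rw [p.toMeasure_apply_singleton α (measurableSet_singleton α),
    ENNReal.ofReal_div_of_pos (by positivity), ENNReal.ofReal_mul hK, ENNReal.ofReal_pow hpos.le,
    ENNReal.ofReal_toReal (p.apply_ne_top α), pow_two, div_eq_mul_inv,
    ENNReal.mul_inv (Or.inl (hp α)) (Or.inl (p.apply_ne_top α)), mul_assoc, mul_assoc, mul_assoc,
    ENNReal.inv_mul_cancel (hp α) (p.apply_ne_top α), mul_one, mul_comm (ENNReal.ofReal (rate β α))]

/-- The mean square error over the draws of the indices. -/
theorem lintegral_empMean_le (p : PMF (MultiIndex D)) (hp : ∀ α, p α ≠ 0) {K : ℝ} (hK : 0 ≤ K)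
    {β : Fin D → ℝ} (hdiag : diagSum p β ≠ ⊤) {d : MultiIndex D → ℝ}
    (hd : ∀ α, d α ^ 2 ≤ K * rate β α) {Nmin m : ℕ} (hN : Nmin ≠ 0) (hm : m ≠ 0) :
    ∫⁻ a, ENNReal.ofReal
        (empMean (fun α => K * rate β α / (p α).toReal ^ 2) a / ((Nmin * m : ℕ) : ℝ) +
          (empMean (fun α => d α / (p α).toReal) a - ∑' α, d α) ^ 2)
        ∂(Measure.pi fun _ : Fin m => p.toMeasure) ≤
      ENNReal.ofReal ((1 + Nmin) * K / ((Nmin * m : ℕ) : ℝ)) * diagSum p β := by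
  have hN' : (Nmin : ℝ) ≠ 0 := Nat.cast_ne_zero.2 hN
  have hm' : (m : ℝ) ≠ 0 := Nat.cast_ne_zero.2 hm
  have hpos (α : MultiIndex D) : 0 < (p α).toReal :=
    ENNReal.toReal_pos (hp α) (p.apply_ne_top α)
  set g : MultiIndex D → ℝ := fun α => K * rate β α / (p α).toReal ^ 2 with hg
  set h : MultiIndex D → ℝ := fun α => d α / (p α).toReal with hh
  have hg0 (α : MultiIndex D) : 0 ≤ g α :=
    div_nonneg (mul_nonneg hK (rate_pos β α).le) (sq_nonneg _)
  have hlint := lintegral_rate_div_sq p hp hK β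
  have hgi : Integrable g p.toMeasure := by
    refine ⟨(measurable_of_countable g).aestronglyMeasurable, ?_⟩
    rw [hasFiniteIntegral_iff_ofReal (ae_of_all _ hg0), hlint]
    exact ENNReal.mul_lt_top ENNReal.ofReal_lt_top hdiag.lt_top
  have hgint : ENNReal.ofReal (∫ α, g α ∂p.toMeasure) = ENNReal.ofReal K * diagSum p β := by
    rw [ofReal_integral_eq_lintegral_ofReal hgi (ae_of_all _ hg0), hlint]
  have hhg (α : MultiIndex D) : h α ^ 2 ≤ g α := by
    rw [hh, hg]
    simp only [div_pow]
    exact div_le_div_of_nonneg_right (hd α) (sq_nonneg _)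
  have hhm : AEStronglyMeasurable h p.toMeasure :=
    (measurable_of_countable h).aestronglyMeasurable
  have hhL : MemLp h 2 p.toMeasure := by
    rw [memLp_two_iff_integrable_sq hhm]
    refine hgi.mono (measurable_of_countable _).aestronglyMeasurable (ae_of_all _ fun α => ?_)
    rw [Real.norm_of_nonneg (sq_nonneg _), Real.norm_of_nonneg (hg0 α)]
    exact hhg α
  have hhint : ∫ α, h α ∂p.toMeasure = ∑' α, d α := by
    rw [PMF.integral_eq_tsum p h (hhL.integrable one_le_two)]
    refine tsum_congr fun α => ?_
    rw [smul_eq_mul, hh, mul_div_cancel₀ _ (hpos α).ne']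
  have hemp : Integrable (empMean (n := m) g) (Measure.pi fun _ : Fin m => p.toMeasure) := by
    have h1 := (integrable_finsetSum Finset.univ fun (i : Fin m) _ =>
      (measurePreserving_eval (fun _ : Fin m => p.toMeasure) i).integrable_comp_of_integrable
        hgi).div_const (m : ℝ)
    refine h1.congr (ae_of_all _ fun a => ?_)
    simp [empMean]
  have hempL := memLp_empMean (n := m) hhL
  have hsq := (hempL.sub (memLp_const (∑' α, d α))).integrable_sq
  have hsum := (hemp.div_const ((Nmin * m : ℕ) : ℝ)).add hsq
  -- The 1 comes from the samplers and `Nmin` from the random indices: their variance is divided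
  -- only by the number of draws `m = N / Nmin`.
  have hval : ∫ a, (empMean g a / ((Nmin * m : ℕ) : ℝ) + (empMean h a - ∑' α, d α) ^ 2)
      ∂(Measure.pi fun _ : Fin m => p.toMeasure) ≤
      (1 + Nmin) / ((Nmin * m : ℕ) : ℝ) * ∫ α, g α ∂p.toMeasure := by
    have hvar : Var[h; p.toMeasure] ≤ ∫ α, g α ∂p.toMeasure :=
      (variance_le_expectation_sq hhm).trans (integral_mono hhL.integrable_sq hgi hhg)
    have h2 := integral_add (hemp.div_const ((Nmin * m : ℕ) : ℝ)) hsq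
    simp only [Pi.sub_apply] at h2
    rw [h2, integral_div, integral_empMean hm hgi, integral_sub_const_sq hempL,
      integral_empMean hm (hhL.integrable one_le_two), hhint, sub_self, variance_empMean hm hhL]
    have h3 := div_le_div_of_nonneg_right hvar (Nat.cast_nonneg (α := ℝ) m)
    refine (add_le_add_right (add_le_add_left h3 _) _).trans_eq ?_
    push_cast
    field_simp
    ring
  have hC : 0 ≤ (1 + Nmin : ℝ) / ((Nmin * m : ℕ) : ℝ) := by positivity
  calc _ = ENNReal.ofReal (∫ a, (empMean g a / ((Nmin * m : ℕ) : ℝ) +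
          (empMean h a - ∑' α, d α) ^ 2) ∂(Measure.pi fun _ : Fin m => p.toMeasure)) :=
        (ofReal_integral_eq_lintegral_ofReal hsum (ae_of_all _ fun a => add_nonneg
          (div_nonneg (empMean_nonneg hg0 a) (Nat.cast_nonneg _)) (sq_nonneg _))).symm
    _ ≤ ENNReal.ofReal ((1 + Nmin) / ((Nmin * m : ℕ) : ℝ) * ∫ α, g α ∂p.toMeasure) :=
        ENNReal.ofReal_le_ofReal hval
    _ = _ := by
        rw [ENNReal.ofReal_mul hC, hgint, ← mul_assoc, ← ENNReal.ofReal_mul hC,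
          div_mul_eq_mul_div]

/-- Taking square roots halves the exponents, and the halved rates remain summable. -/
theorem summable_of_sq_le_rate {β : Fin D → ℝ} (hβ : ∀ i, 0 < β i) {K : ℝ} (hK : 0 ≤ K)
    {d : MultiIndex D → ℝ} (hd : ∀ α, d α ^ 2 ≤ K * rate β α) : Summable d := by
  refine .of_norm_bounded ((summable_rate fun i => half_pos (hβ i)).mul_left √K) fun α => ?_
  refine abs_le_of_sq_le_sq ?_ (mul_nonneg (Real.sqrt_nonneg K) (rate_pos _ α).le)
  rw [mul_pow, Real.sq_sqrt hK, rate_half_sq]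
  exact hd α

/-- The mean square error of the randomized estimator. -/
theorem exists_mse_le {X : Type*} [MeasurableSpace X] {π₀ : Measure X} [IsProbabilityMeasure π₀]
    {L : X → ℝ} {Lα : MultiIndex D → X → ℝ} (hLα : ∀ α, Measurable (Lα α))
    (hLα0 : ∀ α x, 0 ≤ Lα α x) {s : SMCData π₀ Lα} (hG : UniformBounds L s) {ζ : X → ℝ}
    {ζα : MultiIndex D → X → ℝ} (hζα : ∀ α, Measurable (ζα α))
    (hζαb : ∀ α, ∃ B, ∀ x, |ζα α x| ≤ B) (hB : BiasVanishes π₀ L Lα ζ ζα)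
    {β : Fin D → ℝ} (hβ : ∀ i, 0 < β i) (hV : VarianceRate π₀ Lα ζα β)
    {Nmin : ℕ} (hN : Nmin ≠ 0) :
    ∃ C : ℝ, 0 < C ∧ ∀ p : PMF (MultiIndex D), (∀ α, p α ≠ 0) → ∀ m : ℕ, m ≠ 0 →
      mse s L ζ ζα p Nmin m ≤ ENNReal.ofReal (C / ((Nmin * m : ℕ) : ℝ)) * diagSum p β := by
  obtain ⟨C, hC⟩ := hG.exists_boundedRatios
  obtain ⟨K, hK, hmom⟩ := exists_moments_estimatorLaw hC hLα hLα0 hζα hζαb hV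
  refine ⟨(1 + Nmin) * K, by positivity, fun p hp m hm => ?_⟩
  have hNm : (0 : ℝ) < ((Nmin * m : ℕ) : ℝ) :=
    Nat.cast_pos.2 (Nat.mul_pos (Nat.pos_of_ne_zero hN) (Nat.pos_of_ne_zero hm))
  -- With an infinite diagonal sum the bound is `⊤`; otherwise all second moments under `p` are
  -- finite.
  by_cases hdiag : diagSum p β = ⊤
  · rw [hdiag, ENNReal.mul_top (ENNReal.ofReal_pos.2 (by positivity)).ne']
    exact le_top
  have hf : ∑' α, mixedDiff (fun α' => unnorm π₀ (Lα α') (ζα α')) α = unnorm π₀ L ζ :=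
    tsum_mixedDiff_eq hB (summable_of_sq_le_rate hβ hK.le fun α => (hmom α).1)
  rw [mse, rmiLaw, ← hf]
  -- Only an upper bound is needed, and this direction requires no measurability of the conditional
  -- laws or of the estimator.
  refine (Measure.lintegral_bind_le _ _ _).trans (le_trans (lintegral_mono fun a => ?_)
    (lintegral_empMean_le p hp hK.le hdiag (fun α => (hmom α).1) hN hm))
  refine (lintegral_map_le _ _).trans ?_
  exact lintegral_rmiEstimator_le (P := fun α n => s.estimatorLaw (psi Lα ζα α) α n)
    (fun α n => ((hmom α).2 n).1) (fun α n => ((hmom α).2 n).2.1)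
    (fun α n hn => (((hmom α).2 n).2.2 hn).1) (fun α n hn => (((hmom α).2 n).2.2 hn).2)
    p hN hm a _

end Randomized

end MISMC

end

theorem mainTheorem2 {D : ℕ} {X : Type*} [MeasurableSpace X]
    (π₀ : Measure X) [IsProbabilityMeasure π₀]
    (L : X → ℝ) (hL : Measurable L) (hL0 : ∀ x, 0 ≤ L x)
    (Lα : MISMC.MultiIndex D → X → ℝ) (hLα : ∀ α, Measurable (Lα α)) (hLα0 : ∀ α x, 0 ≤ Lα α x)
    (s : MISMC.SMCData π₀ Lα) (hG : MISMC.UniformBounds L s)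
    (ζ : X → ℝ) (hζ : Measurable ζ) (hζb : ∃ B, ∀ x, |ζ x| ≤ B)
    (ζα : MISMC.MultiIndex D → X → ℝ) (hζα : ∀ α, Measurable (ζα α))
    (hζαb : ∀ α, ∃ B, ∀ x, |ζα α x| ≤ B)
    (hB : MISMC.BiasVanishes π₀ L Lα ζ ζα)
    (β : Fin D → ℝ) (hβ : ∀ i, 0 < β i) (hV : MISMC.VarianceRate π₀ Lα ζα β)
    (Nmin : ℕ) (hNmin : 1 ≤ Nmin) :
    (∃ C : ℝ, 0 < C ∧ ∀ p : PMF (MISMC.MultiIndex D), (∀ α, p α ≠ 0) → ∀ m : ℕ, 1 ≤ m →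
      MISMC.mse s L ζ ζα p Nmin m ≤
        ENNReal.ofReal (C / ((Nmin * m : ℕ) : ℝ)) * (MISMC.diagSum p β + MISMC.crossSum β)) ∧
    MISMC.crossSum β ≠ ⊤ ∧
    (∀ K : ℝ, ∃ C : ℝ, 0 < C ∧ ∀ p : PMF (MISMC.MultiIndex D), (∀ α, p α ≠ 0) →
      MISMC.diagSum p β ≤ ENNReal.ofReal K → ∀ m : ℕ, 1 ≤ m →
      MISMC.mse s L ζ ζα p Nmin m ≤ ENNReal.ofReal (C / ((Nmin * m : ℕ) : ℝ))) := by
  obtain ⟨C, hC, hmse⟩ := MISMC.exists_mse_le hLα hLα0 hG hζα hζαb hB hβ hV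
    (Nat.one_le_iff_ne_zero.1 hNmin)
  refine ⟨⟨C, hC, fun p hp m hm => ?_⟩, MISMC.crossSum_ne_top hβ, fun K => ?_⟩
  · exact (hmse p hp m (Nat.one_le_iff_ne_zero.1 hm)).trans (mul_le_mul_right le_self_add _)
  -- The maximum with 1 keeps the constant positive when `K ≤ 0`.
  · refine ⟨C * max K 1, by positivity, fun p hp hK m hm => ?_⟩
    refine (hmse p hp m (Nat.one_le_iff_ne_zero.1 hm)).trans ?_
    rw [mul_div_right_comm, ENNReal.ofReal_mul (by positivity)]
    exact mul_le_mul_right (hK.trans (ENNReal.ofReal_le_ofReal (le_max_left K 1))) _
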